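/- Let $(M^4,g)$ be a smooth oriented Riemannian four-manifold with Levi-Civita connection $\nabla$, curvature conventions $[\nabla_a,\nabla_b]v^c=R_{ab}{}^c{}_d v^d$, $R_{bd}=R_{ab}{}^a{}_d$, Schouten tensor $P_{ab}=\frac12\left(R_{ab}-\frac{R}{6}g_{ab}\right)$, and Weyl tensor $W_{abcd}=R_{abcd}-\left(g_{ca}P_{bd}-g_{cb}P_{ad}+g_{db}P_{ac}-g_{da}P_{bc}\right)$. Assume that $(M,g)$ is anti-self-dual, i.e. the self-dual part $W^+$ of $W$ vanishes. Let $U_{ijkl}$ be a smooth self-dual Weyl-type tensor: $U_{ijkl}=-U_{jikl}=-U_{ijlk}=U_{klij}$, $U_{ijkl}+U_{jkil}+U_{kijl}=0$, all its metric contractions vanish, and it is self-dual in the indices $ij$. Put $(\delta U)_{kij}=\nabla^mU_{mkij}$ and $$(\mathcal D^*U)_{ij}=2\left(\nabla^k\nabla^\ell U_{ikj\ell}+P^{k\ell}U_{ikj\ell}\right).$$ By means of $g$ write sections of the standard (co)tractor bundle $\mathcal T^*=\mathbb R\oplus T^*M\oplus\mathbb R$ as $V_A=\sigma Y_A+\mu_aZ_A{}^a+\rho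 X_A$, with the tractor connection $$\nabla_a(\sigma,\mu_b,\rho)=\left(\nabla_a\sigma-\mu_a,\ \nabla_a\mu_b+P_{ab}\sigma+g_{ab}\rho,\ \nabla_a\rho-P_{ac}\mu^c\right),$$ and define the two-form $z=z(U)$ with values in the adjoint tractor bundle $\Lambda^2\mathcal T^*$ (identified with $\Lambda^2\mathcal T$ by the tractor metric) by $$z_{ijAB}=\tfrac12U_{ijk\ell}\left(Z_A{}^kZ_B{}^\ell-Z_A{}^\ell Z_B{}^k\right)-(\delta U)_{kij}\left(X_AZ_B{}^k-Z_A{}^kX_B\right).$$ Let $\nabla$ also denote the coupled Levi-Civita--tractor connection, and put $(\delta z)_{jAB}=g^{im}\nabla_mz_{ijAB}$ and $(d^\nabla z)_{mijAB}=\nabla_mz_{ijAB}+\nabla_iz_{jmAB}+\nabla_jz_{miAB}$. Call $z$ harmonic if $d^\nabla z=0$ and $\delta z=0$, and self-dual if $\star z=z$, where $\star$ acts on the two-form indices $ij$. Then $\mathcal D^*U=0$ if and only if $z(U)$ is a harmonic self-dual two-form. Moreover $$(\delta z)_{jAB}=-\tfrac12(\mathcal D^*U)_{j\ell}\left(X_AZ_B{}^\ell-Z_A{}^\ell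 X_B\right).$$ -/

import Mathlib

open scoped Manifold ContDiff

noncomputable section

namespace ASDTractor

/-- The model space of four-manifolds. -/
abbrev E4 : Type := EuclideanSpace ℝ (Fin 4)

/-! ### Local tensor calculus

On the target of a chart a covariant tensor of rank `n` is the family of its component functions,
indexed by multi-indices `Fin n → Fin 4`. The metric is the matrix-valued function `G` of its
components `g_{ab}`. All conventions for the curvature are those of the identities
`[∇_a, ∇_b] v^c = R_{ab}{}^c{}_d v^d` and `R_{bd} = R_{ab}{}^a{}_d`. -/

section Local

/-- The partial derivative `∂_m f` at `y`. -/
def pd (m : Fin 4) (f : E4 → ℝ) (y : E4) : ℝ :=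
  fderiv ℝ f y (EuclideanSpace.single m 1)

variable (G : E4 → Matrix (Fin 4) (Fin 4) ℝ)

/-- The inverse metric `g^{ab}`. -/
def ginv (y : E4) (a b : Fin 4) : ℝ := (G y)⁻¹ a b

/-- The Christoffel symbols `Γ^c_{ab}` of the Levi-Civita connection. -/
def christoffel (y : E4) (c a b : Fin 4) : ℝ :=
  (1 / 2) * ∑ d, ginv G y c d *
    (pd a (fun x => G x b d) y + pd b (fun x => G x a d) y - pd d (fun x => G x a b) y)

/-- The curvature `R_{ab}{}^c{}_d`, with index order `a b c d`. -/
def riemannMixed (y : E4) (a b c d : Fin 4) : ℝ :=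
  pd a (fun x => christoffel G x c b d) y - pd b (fun x => christoffel G x c a d) y
    + ∑ e, (christoffel G y c a e * christoffel G y e b d
      - christoffel G y c b e * christoffel G y e a d)

/-- The curvature `R_{abcd} = g_{ce} R_{ab}{}^e{}_d`. -/
def riemann (y : E4) (a b c d : Fin 4) : ℝ := ∑ e, G y c e * riemannMixed G y a b e d

/-- The Ricci tensor `R_{bd} = R_{ab}{}^a{}_d`. -/
def ricci (y : E4) (b d : Fin 4) : ℝ := ∑ a, riemannMixed G y a b a d

/-- The scalar curvature. -/
def scalar (y : E4) : ℝ := ∑ a, ∑ b, ginv G y a b * ricci G y a b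

/-- The Schouten tensor `P_{ab}` in dimension four. -/
def schouten (y : E4) (a b : Fin 4) : ℝ :=
  (1 / 2) * (ricci G y a b - scalar G y / 6 * G y a b)

/-- The Weyl tensor `W_{abcd}`. -/
def weyl (y : E4) (a b c d : Fin 4) : ℝ :=
  riemann G y a b c d
    - (G y c a * schouten G y b d - G y c b * schouten G y a d
      + G y d b * schouten G y a c - G y d a * schouten G y b c)

/-- The Levi-Civita symbol, with value `1` at `(0, 1, 2, 3)`. -/
def leviCivitaSymbol (i j k l : Fin 4) : ℝ :=
  Matrix.det (Matrix.of fun a b : Fin 4 => if ![i, j, k, l] a = b then (1 : ℝ) else 0)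

/-- The components `ε_{ijkl}` of the Riemannian volume form in a positively oriented chart. -/
def volForm (y : E4) (i j k l : Fin 4) : ℝ :=
  Real.sqrt (G y).det * leviCivitaSymbol i j k l

/-- The Hodge star on two-forms at `y`: `(⋆η)_{ij} = ½ ε_{ij}{}^{kl} η_{kl}`. -/
def star2 (y : E4) (η : Fin 4 → Fin 4 → ℝ) (i j : Fin 4) : ℝ :=
  (1 / 2) * ∑ a, ∑ b, ∑ k, ∑ l,
    volForm G y i j a b * ginv G y a k * ginv G y b l * η k l

/-- The self-dual Weyl tensor `W⁺`, the image of `W` under the projection of two-forms to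
self-dual two-forms. -/
def weylPlus (y : E4) (i j k l : Fin 4) : ℝ :=
  (1 / 2) * (weyl G y i j k l + star2 G y (fun p q => weyl G y p q k l) i j)

/-- The Levi-Civita covariant derivative of a covariant tensor of rank `n`; the new index is the
first one: `(∇T)_{m I} = ∂_m T_I - ∑_s Γ^c_{m I_s} T_{I_1 … c … I_n}`. -/
def cov {n : ℕ} (T : E4 → (Fin n → Fin 4) → ℝ) (y : E4) (J : Fin (n + 1) → Fin 4) : ℝ :=
  pd (J 0) (fun x => T x (Fin.tail J)) y
    - ∑ s : Fin n, ∑ c, christoffel G y c (J 0) (Fin.tail J s)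
        * T y (Function.update (Fin.tail J) s c)

/-- The divergence `(δU)_{kij} = ∇^m U_{mkij}`. -/
def div4 (U : E4 → (Fin 4 → Fin 4) → ℝ) (y : E4) (k i j : Fin 4) : ℝ :=
  ∑ m, ∑ n, ginv G y m n * cov G U y ![n, m, k, i, j]

/-- The operator `(𝒟*U)_{ij} = 2 (∇^k ∇^l U_{ikjl} + P^{kl} U_{ikjl})`. -/
def dStar (U : E4 → (Fin 4 → Fin 4) → ℝ) (y : E4) (i j : Fin 4) : ℝ :=
  2 * ∑ k, ∑ l, ∑ a, ∑ b, ginv G y k a * ginv G y l b *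
    (cov G (cov G U) y ![a, b, i, k, j, l] + schouten G y a b * U y ![i, k, j, l])

/-! ### Tractors

In the splitting of the standard (co)tractor bundle `ℰ_A = ℝ ⊕ T*M ⊕ ℝ` determined by the metric, a
tractor `V_A = σ Y_A + μ_a Z_A{}^a + ρ X_A` is given by its three slots `(σ, μ_a, ρ)`. -/

/-- Tractor indices: the top slot, the four components of the middle slot, the bottom slot. -/
abbrev TIdx : Type := Unit ⊕ Fin 4 ⊕ Unit

/-- The tractor with slots `(σ, μ, ρ)`. -/
def mkTractor (σ : ℝ) (μ : Fin 4 → ℝ) (ρ : ℝ) : TIdx → ℝ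
  | .inl _ => σ
  | .inr (.inl b) => μ b
  | .inr (.inr _) => ρ

/-- The projector `Y_A`. -/
def projY : TIdx → ℝ := mkTractor 1 0 0

/-- The projector `Z_A{}^a`. -/
def projZ (a : Fin 4) : TIdx → ℝ := mkTractor 0 (Pi.single a 1) 0

/-- The projector (canonical tractor) `X_A`. -/
def projX : TIdx → ℝ := mkTractor 0 0 1

/-- The matrix of the tractor connection in the frame given by the metric splitting and the
coordinate coframe: `∇_m V_A = ∂_m V_A + ∑_B (tractorMatrix m)_{AB} V_B`. -/
def tractorMatrix (y : E4) (m : Fin 4) : TIdx → TIdx → ℝ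
  | .inl _, .inr (.inl b) => if m = b then -1 else 0
  | .inr (.inl b), .inl _ => schouten G y m b
  | .inr (.inl b), .inr (.inl c) => -christoffel G y c m b
  | .inr (.inl b), .inr (.inr _) => G y m b
  | .inr (.inr _), .inr (.inl c) => -∑ d, schouten G y m d * ginv G y d c
  | _, _ => 0

/-- The tractor connection on sections of the standard (co)tractor bundle. -/
def tractorD (V : E4 → TIdx → ℝ) (y : E4) (m : Fin 4) (A : TIdx) : ℝ :=
  pd m (fun x => V x A) y + ∑ B, tractorMatrix G y m A B * V y B

/-- The slots of `tractorD`: the tractor connection sends `(σ, μ_b, ρ)` to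
`(∇_m σ - μ_m, ∇_m μ_b + P_{mb} σ + g_{mb} ρ, ∇_m ρ - P_{mc} μ^c)`. -/
theorem tractorD_mkTractor (σ : E4 → ℝ) (μ : E4 → Fin 4 → ℝ) (ρ : E4 → ℝ) (y : E4) (m : Fin 4) :
    tractorD G (fun x => mkTractor (σ x) (μ x) (ρ x)) y m =
      mkTractor (pd m σ y - μ y m)
        (fun b => (pd m (fun x => μ x b) y - ∑ c, christoffel G y c m b * μ y c)
          + schouten G y m b * σ y + G y m b * ρ y)
        (pd m ρ y - ∑ c, schouten G y m c * ∑ d, ginv G y c d * μ y d) := by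
  funext A
  rcases A with _ | b | _
  · simp [tractorD, tractorMatrix, mkTractor, Fintype.sum_sum_type, sub_eq_add_neg]
  · simp [tractorD, tractorMatrix, mkTractor, Fintype.sum_sum_type]
    ring
  · simp only [tractorD, tractorMatrix, mkTractor, Fintype.sum_sum_type, Finset.univ_unique,
      Finset.sum_singleton, Finset.mul_sum, Finset.sum_mul, neg_mul, Finset.sum_neg_distrib]
    rw [Finset.sum_comm]
    simp [mul_assoc, sub_eq_add_neg]

/-- The coupled Levi-Civita and tractor covariant derivative `∇_m z_{ijAB}` of a two-form with
values in `ℰ_{AB}`. -/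
def covTractorForm (z : E4 → Fin 4 → Fin 4 → TIdx → TIdx → ℝ) (y : E4) (m i j : Fin 4)
    (A B : TIdx) : ℝ :=
  pd m (fun x => z x i j A B) y
    - ∑ c, christoffel G y c m i * z y c j A B - ∑ c, christoffel G y c m j * z y i c A B
    + ∑ C, tractorMatrix G y m A C * z y i j C B + ∑ C, tractorMatrix G y m B C * z y i j A C

/-- The exterior covariant derivative
`(d^∇ z)_{mijAB} = ∇_m z_{ijAB} + ∇_i z_{jmAB} + ∇_j z_{miAB}`. -/
def dTractor (z : E4 → Fin 4 → Fin 4 → TIdx → TIdx → ℝ) (y : E4) (m i j : Fin 4)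
    (A B : TIdx) : ℝ :=
  covTractorForm G z y m i j A B + covTractorForm G z y i j m A B + covTractorForm G z y j m i A B

/-- The divergence `(δz)_{jAB} = g^{im} ∇_m z_{ijAB}`. -/
def deltaTractor (z : E4 → Fin 4 → Fin 4 → TIdx → TIdx → ℝ) (y : E4) (j : Fin 4)
    (A B : TIdx) : ℝ :=
  ∑ i, ∑ m, ginv G y i m * covTractorForm G z y m i j A B

/-- The two-form `z(U)` with values in the adjoint tractor bundle,
`z_{ijAB} = ½ U_{ijkl} (Z_A{}^k Z_B{}^l - Z_A{}^l Z_B{}^k)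
  - (δU)_{kij} (X_A Z_B{}^k - Z_A{}^k X_B)`. -/
def zOf (U : E4 → (Fin 4 → Fin 4) → ℝ) (y : E4) (i j : Fin 4) (A B : TIdx) : ℝ :=
  (1 / 2) * ∑ k, ∑ l, U y ![i, j, k, l] * (projZ k A * projZ l B - projZ l A * projZ k B)
    - ∑ k, div4 G U y k i j * (projX A * projZ k B - projZ k A * projX B)

end Local

/-! ### Oriented Riemannian four-manifolds -/

section Global

variable (M : Type*) [TopologicalSpace M] [ChartedSpace E4 M]

/-- An orientation of a smooth four-manifold, given by an oriented smooth atlas. -/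
structure OrientedAtlas where
  charts : Set (OpenPartialHomeomorph M E4)
  smooth : charts ⊆ IsManifold.maximalAtlas (𝓡 4) ∞ M
  cover : ∀ p : M, ∃ e ∈ charts, p ∈ e.source
  jacobian_pos : ∀ e ∈ charts, ∀ e' ∈ charts, ∀ y ∈ (e.symm.trans e').source,
    0 < (fderiv ℝ (e.symm.trans e') y).det

variable {M}

/-- The coordinate vector field `∂_i` of the chart `e`, at the point with coordinates `y`. -/
def coordVec (e : OpenPartialHomeomorph M E4) (y : E4) (i : Fin 4) :
    TangentSpace (𝓡 4) (e.symm y) :=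
  mfderiv (𝓡 4) (𝓡 4) e.symm y (EuclideanSpace.single i 1 : E4)

/-- A covariant tensor field of rank `n`. -/
abbrev TensorField (M : Type*) [TopologicalSpace M] [ChartedSpace E4 M] (n : ℕ) :=
  ∀ p : M, ContinuousMultilinearMap ℝ (fun _ : Fin n => TangentSpace (𝓡 4) p) ℝ

/-- The components of a tensor field in the chart `e`. -/
def TensorField.comp {n : ℕ} (T : TensorField M n) (e : OpenPartialHomeomorph M E4)
    (y : E4) (I : Fin n → Fin 4) : ℝ :=
  T (e.symm y) (fun s => coordVec e y (I s))

variable [IsManifold (𝓡 4) ∞ M]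

/-- A smooth Riemannian metric. -/
abbrev SmoothMetric (M : Type*) [TopologicalSpace M] [ChartedSpace E4 M]
    [IsManifold (𝓡 4) ∞ M] :=
  Bundle.ContMDiffRiemannianMetric (𝓡 4) ∞ E4 (fun p : M => TangentSpace (𝓡 4) p)

/-- The components `g_{ij}` of the metric in the chart `e`. -/
def metricComp (g : SmoothMetric M) (e : OpenPartialHomeomorph M E4) (y : E4) :
    Matrix (Fin 4) (Fin 4) ℝ :=
  Matrix.of fun i j => g.inner (e.symm y) (coordVec e y i) (coordVec e y j)

/-- `(M, g)` is anti-self-dual: `W⁺ = 0`. -/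
def IsASD (o : OrientedAtlas M) (g : SmoothMetric M) : Prop :=
  ∀ e ∈ o.charts, ∀ y ∈ e.target, ∀ i j k l, weylPlus (metricComp g e) y i j k l = 0

/-- `U` is a smooth section of `𝒲⁺`: it has the algebraic symmetries of the Weyl tensor, it is
trace-free and self-dual. -/
structure IsSDWeylField (o : OrientedAtlas M) (g : SmoothMetric M) (U : TensorField M 4) :
    Prop where
  smooth : ∀ e ∈ o.charts, ∀ I, ContDiffOn ℝ ∞ (fun y => U.comp e y I) e.target
  skew_left : ∀ e ∈ o.charts, ∀ y ∈ e.target, ∀ i j k l,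
    U.comp e y ![j, i, k, l] = -U.comp e y ![i, j, k, l]
  skew_right : ∀ e ∈ o.charts, ∀ y ∈ e.target, ∀ i j k l,
    U.comp e y ![i, j, l, k] = -U.comp e y ![i, j, k, l]
  pair_symm : ∀ e ∈ o.charts, ∀ y ∈ e.target, ∀ i j k l,
    U.comp e y ![k, l, i, j] = U.comp e y ![i, j, k, l]
  bianchi : ∀ e ∈ o.charts, ∀ y ∈ e.target, ∀ i j k l,
    U.comp e y ![i, j, k, l] + U.comp e y ![j, k, i, l] + U.comp e y ![k, i, j, l] = 0
  trace_free : ∀ e ∈ o.charts, ∀ y ∈ e.target, ∀ j l,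
    ∑ i, ∑ k, ginv (metricComp g e) y i k * U.comp e y ![i, j, k, l] = 0
  self_dual : ∀ e ∈ o.charts, ∀ y ∈ e.target, ∀ i j k l,
    star2 (metricComp g e) y (fun p q => U.comp e y ![p, q, k, l]) i j = U.comp e y ![i, j, k, l]

/-- `U ∈ ker 𝒟*`. -/
def InKerDStar (o : OrientedAtlas M) (g : SmoothMetric M) (U : TensorField M 4) : Prop :=
  ∀ e ∈ o.charts, ∀ y ∈ e.target, ∀ i j, dStar (metricComp g e) (U.comp e) y i j = 0

/-- The components in the chart `e` of the adjoint-tractor-valued two-form `z(U)`. -/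
def zComp (g : SmoothMetric M) (U : TensorField M 4) (e : OpenPartialHomeomorph M E4) :
    E4 → Fin 4 → Fin 4 → TIdx → TIdx → ℝ :=
  zOf (metricComp g e) (U.comp e)

/-- `z(U)` is self-dual as a two-form: `⋆z = z`. -/
def ZIsSelfDual (o : OrientedAtlas M) (g : SmoothMetric M) (U : TensorField M 4) : Prop :=
  ∀ e ∈ o.charts, ∀ y ∈ e.target, ∀ i j A B,
    star2 (metricComp g e) y (fun p q => zComp g U e y p q A B) i j = zComp g U e y i j A B

/-- `z(U)` is harmonic: `d^∇ z = 0` and `δz = 0`. -/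
def ZIsHarmonic (o : OrientedAtlas M) (g : SmoothMetric M) (U : TensorField M 4) : Prop :=
  ∀ e ∈ o.charts, ∀ y ∈ e.target,
    (∀ m i j A B, dTractor (metricComp g e) (zComp g U e) y m i j A B = 0) ∧
    (∀ j A B, deltaTractor (metricComp g e) (zComp g U e) y j A B = 0)

end Global

end ASDTractor

end

noncomputable section

namespace ASDTractor

section Chart

variable {M : Type*} [TopologicalSpace M] [ChartedSpace E4 M] [IsManifold (𝓡 4) ∞ M]

theorem contMDiffOn_coordVec {e : OpenPartialHomeomorph M E4}
    (he : e ∈ IsManifold.maximalAtlas (𝓡 4) ∞ M) (i : Fin 4) :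
    ContMDiffOn (𝓡 4) (𝓡 4).tangent ∞
      (fun y => Bundle.TotalSpace.mk' E4 (E := fun p : M => TangentSpace (𝓡 4) p)
        (e.symm y) (coordVec e y i)) e.target := by
  have h1 : ContMDiffOn (𝓡 4) (𝓡 4) ∞ e.symm e.target := contMDiffOn_symm_of_mem_maximalAtlas he
  have h2 := h1.contMDiffOn_tangentMapWithin (m := ∞) le_rfl e.open_target.uniqueMDiffOn
  have h3 : ContMDiff (𝓡 4) (𝓡 4).tangent ∞
      (fun y : E4 => (⟨y, (EuclideanSpace.single i 1 : E4)⟩ : TangentBundle (𝓡 4) E4)) := by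
    exact contMDiff_vectorSpace_iff_contDiff.mpr contDiff_const
  have h4 := h2.comp h3.contMDiffOn (s := e.target) (fun y hy => hy)
  refine h4.congr fun y hy => ?_
  simp only [Function.comp, tangentMapWithin]
  rw [mfderivWithin_of_mem_nhds (e.open_target.mem_nhds hy)]
  rfl

theorem contDiffOn_metricComp (g : SmoothMetric M) {e : OpenPartialHomeomorph M E4}
    (he : e ∈ IsManifold.maximalAtlas (𝓡 4) ∞ M) (i j : Fin 4) :
    ContDiffOn ℝ ∞ (fun y => metricComp g e y i j) e.target := by
  have h1 : ContMDiffOn (𝓡 4) (𝓡 4) ∞ e.symm e.target := contMDiffOn_symm_of_mem_maximalAtlas he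
  have h2 := g.contMDiff.comp_contMDiffOn h1
  have h3 := ContMDiffOn.clm_bundle_apply₂ (F₃ := ℝ) (E₃ := fun _ : M => ℝ)
    h2 (contMDiffOn_coordVec he i) (contMDiffOn_coordVec he j)
  rw [← contMDiffOn_iff_contDiffOn]
  intro y hy
  have h4 := h3 y hy
  rw [Bundle.contMDiffWithinAt_totalSpace] at h4
  exact h4.2

omit [IsManifold (𝓡 4) ∞ M] in
theorem coordVec_sum (e : OpenPartialHomeomorph M E4) (y : E4) (x : Fin 4 → ℝ) :
    ∑ i, x i • coordVec e y i =
      mfderiv (𝓡 4) (𝓡 4) e.symm y (WithLp.toLp 2 x : E4) := by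
  have : (WithLp.toLp 2 x : E4) = ∑ i, x i • (EuclideanSpace.single i 1 : E4) := by
    ext k
    simp [Pi.single_apply]
  rw [this]
  erw [map_sum]
  refine Finset.sum_congr rfl fun i _ => ?_
  erw [map_smul]
  rfl

theorem metricComp_symm (g : SmoothMetric M) (e : OpenPartialHomeomorph M E4) (y : E4)
    (i j : Fin 4) : metricComp g e y i j = metricComp g e y j i :=
  g.symm _ _ _

theorem metricComp_posDef (g : SmoothMetric M) {e : OpenPartialHomeomorph M E4}
    (he : e ∈ IsManifold.maximalAtlas (𝓡 4) ∞ M) {y : E4} (hy : y ∈ e.target) :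
    (metricComp g e y).PosDef := by
  have hinj : Function.Injective (mfderiv (𝓡 4) (𝓡 4) e.symm y) :=
    by
    have hd : e.MDifferentiable (𝓡 4) (𝓡 4) :=
      ⟨(contMDiffOn_of_mem_maximalAtlas he).mdifferentiableOn (by simp),
        (contMDiffOn_symm_of_mem_maximalAtlas he).mdifferentiableOn (by simp)⟩
    exact hd.symm.mfderiv_injective hy
  refine Matrix.PosDef.of_dotProduct_mulVec_pos ?_ ?_
  · ext i j
    exact metricComp_symm g e y _ _
  · intro x hx
    have hv : (∑ i, x i • coordVec e y i) ≠ 0 := by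
      rw [coordVec_sum]
      intro h
      apply hx
      have := hinj (h.trans (map_zero _).symm)
      ext i
      exact congrArg (fun v : E4 => v i) this
    have := g.pos _ _ hv
    refine this.trans_eq ?_
    have hL : ∀ w : TangentSpace (𝓡 4) (e.symm y), g.inner (e.symm y) (∑ i, x i • coordVec e y i) w
        = ∑ i, x i * g.inner (e.symm y) (coordVec e y i) w := by
      intro w
      rw [map_sum, sum_apply]
      simp
    rw [hL]
    simp [dotProduct, Matrix.mulVec, Finset.mul_sum, metricComp, mul_comm]

end Chart

section Algebra

theorem sum_det_updateRow {n : ℕ} (N K : Matrix (Fin n) (Fin n) ℝ) :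
    ∑ s, (N.updateRow s (K s)).det = (K * N.adjugate).trace := by
  simp only [Matrix.trace, Matrix.diag, Matrix.mul_apply]
  refine Finset.sum_congr rfl fun s _ => ?_
  rw [← Matrix.cramer_transpose_apply, Matrix.cramer_eq_adjugate_mulVec, Matrix.mulVec,
    dotProduct, ← Matrix.adjugate_transpose]
  exact Finset.sum_congr rfl fun j _ => mul_comm _ _

/-- The rows of the Levi-Civita symbol. -/
def epsMat (I : Fin 4 → Fin 4) : Matrix (Fin 4) (Fin 4) ℝ :=
  Matrix.of fun a b => if I a = b then (1 : ℝ) else 0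

theorem leviCivitaSymbol_eq (i j k l : Fin 4) :
    leviCivitaSymbol i j k l = (epsMat ![i, j, k, l]).det := rfl

theorem epsMat_mul (I : Fin 4 → Fin 4) (A : Matrix (Fin 4) (Fin 4) ℝ) :
    epsMat I * A = Matrix.of fun a b => A (I a) b := by
  ext a b
  simp [epsMat, Matrix.mul_apply]

theorem sum_mul_det_epsMat_update (A : Matrix (Fin 4) (Fin 4) ℝ) (I : Fin 4 → Fin 4) :
    ∑ s, ∑ c, A (I s) c * (epsMat (Function.update I s c)).det = A.trace * (epsMat I).det := by
  have h1 : ∀ s, ∑ c, A (I s) c * (epsMat (Function.update I s c)).det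
      = ((epsMat I).updateRow s ((epsMat I * A) s)).det := by
    intro s
    have h2 : (epsMat I * A) s = ∑ c, A (I s) c • (fun b => if c = b then (1 : ℝ) else 0) := by
      ext b
      simp [epsMat_mul]
    rw [h2]
    have h4 : ∀ c, epsMat (Function.update I s c)
        = (epsMat I).updateRow s (fun b => if c = b then (1 : ℝ) else 0) := by
      intro c
      ext a b
      by_cases h : a = s
      · subst h; simp [epsMat]
      · simp [epsMat, h]
    simp only [h4, ← Matrix.cramer_transpose_apply, map_sum, map_smul, Finset.sum_apply,
      Pi.smul_apply, smul_eq_mul]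
  rw [Finset.sum_congr rfl fun s _ => h1 s, sum_det_updateRow, Matrix.mul_assoc,
    Matrix.trace_mul_comm, Matrix.mul_assoc, Matrix.adjugate_mul]
  simp [mul_comm]

/-- The infinitesimal invariance of the Levi-Civita symbol. -/
theorem sum_mul_leviCivitaSymbol (A : Matrix (Fin 4) (Fin 4) ℝ) (i j k l : Fin 4) :
    ∑ c, A i c * leviCivitaSymbol c j k l + ∑ c, A j c * leviCivitaSymbol i c k l
      + ∑ c, A k c * leviCivitaSymbol i j c l + ∑ c, A l c * leviCivitaSymbol i j k c
      = A.trace * leviCivitaSymbol i j k l := by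
  have h := sum_mul_det_epsMat_update A ![i, j, k, l]
  rw [Fin.sum_univ_four] at h
  have u0 : ∀ c, Function.update ![i, j, k, l] 0 c = ![c, j, k, l] := by
    intro c; ext a; fin_cases a <;> rfl
  have u1 : ∀ c, Function.update ![i, j, k, l] 1 c = ![i, c, k, l] := by
    intro c; ext a; fin_cases a <;> rfl
  have u2 : ∀ c, Function.update ![i, j, k, l] 2 c = ![i, j, c, l] := by
    intro c; ext a; fin_cases a <;> rfl
  have u3 : ∀ c, Function.update ![i, j, k, l] 3 c = ![i, j, k, c] := by
    intro c; ext a; fin_cases a <;> rfl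
  simp only [u0, u1, u2, u3] at h
  exact h

theorem sum_pi_fin_succ {n : ℕ} (F : (Fin (n + 1) → Fin 4) → ℝ) :
    ∑ f, F f = ∑ a, ∑ f : Fin n → Fin 4, F (Matrix.vecCons a f) := by
  rw [← (Fin.consEquiv (fun _ : Fin (n + 1) => Fin 4)).sum_comp, Fintype.sum_prod_type]
  rfl

theorem sum_pi_fin_four (F : (Fin 4 → Fin 4) → ℝ) :
    ∑ f, F f = ∑ a, ∑ b, ∑ c, ∑ d, F ![a, b, c, d] := by
  simp only [sum_pi_fin_succ]
  simp only [Finset.univ_unique, Finset.sum_singleton]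
  congr! 12

theorem sum_prod_mul_det_epsMat (N : Matrix (Fin 4) (Fin 4) ℝ) :
    ∑ f : Fin 4 → Fin 4, (∏ s, N s (f s)) * (epsMat f).det = N.det := by
  have h := (Matrix.detRowAlternating (R := ℝ) (n := Fin 4)).toMultilinearMap.map_sum
    (g := fun s c => N s c • (fun b => if c = b then (1 : ℝ) else 0))
  have h2 : (fun s => ∑ c, N s c • (fun b : Fin 4 => if c = b then (1 : ℝ) else 0)) = N := by
    ext s b
    simp
  rw [h2] at h
  refine Eq.trans ?_ h.symm
  refine Finset.sum_congr rfl fun f _ => ?_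
  rw [MultilinearMap.map_smul_univ]
  rfl

/-- Raising all the indices of the Levi-Civita symbol. -/
theorem sum_mul_leviCivitaSymbol_four (H : Matrix (Fin 4) (Fin 4) ℝ) (i j k l : Fin 4) :
    ∑ a, ∑ b, ∑ c, ∑ d, H i a * H j b * H k c * H l d * leviCivitaSymbol a b c d
      = H.det * leviCivitaSymbol i j k l := by
  have h := sum_prod_mul_det_epsMat (Matrix.of fun a b => H (![i, j, k, l] a) b)
  rw [← epsMat_mul, Matrix.det_mul, sum_pi_fin_four] at h
  simp only [Fin.prod_univ_four] at h
  rw [mul_comm, leviCivitaSymbol_eq, ← h, epsMat_mul]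
  rfl

theorem leviCivitaSymbol_swap_left (i j k l : Fin 4) :
    leviCivitaSymbol j i k l = -leviCivitaSymbol i j k l := by
  rw [leviCivitaSymbol_eq, leviCivitaSymbol_eq]
  have := Matrix.det_permute (Equiv.swap (0 : Fin 4) 1) (epsMat ![i, j, k, l])
  rw [Equiv.Perm.sign_swap (by decide)] at this
  have h2 : epsMat ![j, i, k, l] = (epsMat ![i, j, k, l]).submatrix (Equiv.swap (0 : Fin 4) 1) id := by
    ext a b
    fin_cases a <;> rfl
  rw [h2, this]
  simp

theorem leviCivitaSymbol_eq_vandermonde (i j k l : Fin 4) :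
    12 * leviCivitaSymbol i j k l =
      ((j : ℕ) - (i : ℕ) : ℝ) * ((k : ℕ) - (i : ℕ)) * ((l : ℕ) - (i : ℕ)) *
        ((k : ℕ) - (j : ℕ)) * ((l : ℕ) - (j : ℕ)) * ((l : ℕ) - (k : ℕ)) := by
  have h : (epsMat ![i, j, k, l]).det * (Matrix.vandermonde fun a : Fin 4 => ((a : ℕ) : ℝ)).det
      = (Matrix.vandermonde fun a : Fin 4 => ((![i, j, k, l] a : ℕ) : ℝ)).det := by
    rw [← Matrix.det_mul, epsMat_mul]
    rfl
  have h0 : ∀ v : Fin 4 → ℝ, (Matrix.vandermonde v).det =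
      (v 1 - v 0) * (v 2 - v 0) * (v 3 - v 0) * (v 2 - v 1) * (v 3 - v 1) * (v 3 - v 2) := by
    intro v
    have e0 : Finset.Ioi (0 : Fin 4) = {1, 2, 3} := by decide
    have e1 : Finset.Ioi (1 : Fin 4) = {2, 3} := by decide
    have e2 : Finset.Ioi (2 : Fin 4) = {3} := by decide
    have e3 : Finset.Ioi (3 : Fin 4) = ∅ := by decide
    rw [Matrix.det_vandermonde, Fin.prod_univ_four, e0, e1, e2, e3]
    simp [-mul_eq_mul_right_iff, -mul_eq_mul_left_iff, mul_assoc]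
  rw [h0, h0] at h
  rw [leviCivitaSymbol_eq]
  have h12 : (((1 : Fin 4) : ℕ) - ((0 : Fin 4) : ℕ) : ℝ) * (((2 : Fin 4) : ℕ) - ((0 : Fin 4) : ℕ)) *
    (((3 : Fin 4) : ℕ) - ((0 : Fin 4) : ℕ)) * (((2 : Fin 4) : ℕ) - ((1 : Fin 4) : ℕ)) *
    (((3 : Fin 4) : ℕ) - ((1 : Fin 4) : ℕ)) * (((3 : Fin 4) : ℕ) - ((2 : Fin 4) : ℕ)) = 12 := by
    norm_num
  rw [h12, mul_comm] at h
  exact h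

set_option maxHeartbeats 2000000 in
theorem cyclic_sum_eq_zero_of_contraction {T : Fin 4 → Fin 4 → Fin 4 → ℝ}
    (hs : ∀ m i j, T m j i = -T m i j)
    (h : ∀ n, ∑ m, ∑ k, ∑ l, leviCivitaSymbol n m k l * T m k l = 0) (m i j : Fin 4) :
    T m i j + T i j m + T j m i = 0 := by
  have h' : ∀ n : Fin 4, ∑ m, ∑ k, ∑ l, 12 * leviCivitaSymbol n m k l * T m k l = 0 := by
    intro n
    rw [← mul_zero (12 : ℝ), ← h n]
    simp only [Finset.mul_sum, mul_assoc]
  simp only [leviCivitaSymbol_eq_vandermonde, Fin.sum_univ_four] at h'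
  have h0 := h' 0
  have h1 := h' 1
  have h2 := h' 2
  have h3 := h' 3
  have hd : ∀ m i, T m i i = 0 := fun m i => by linarith [hs m i i]
  norm_num at h0 h1 h2 h3
  have s10 := fun m => hs m 0 1
  have s20 := fun m => hs m 0 2
  have s30 := fun m => hs m 0 3
  have s21 := fun m => hs m 1 2
  have s31 := fun m => hs m 1 3
  have s32 := fun m => hs m 2 3
  simp only [s10, s20, s30, s21, s31, s32] at h0 h1 h2 h3
  clear h h'
  fin_cases m <;> fin_cases i <;> fin_cases j <;>
    simp only [Fin.zero_eta, Fin.mk_one, Fin.reduceFinMk, hd, s10, s20, s30, s21, s31, s32] <;>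
    linarith

variable {G : E4 → Matrix (Fin 4) (Fin 4) ℝ} {y : E4}

theorem sum_comm_four_two (F : Fin 4 → Fin 4 → Fin 4 → Fin 4 → Fin 4 → Fin 4 → ℝ) :
    ∑ i, ∑ j, ∑ a, ∑ b, ∑ k, ∑ l, F i j a b k l = ∑ k, ∑ l, ∑ i, ∑ j, ∑ a, ∑ b, F i j a b k l := by
  have h := Finset.sum_comm (s := (Finset.univ : Finset (Fin 4 × Fin 4 × Fin 4 × Fin 4)))
    (t := (Finset.univ : Finset (Fin 4 × Fin 4)))
    (f := fun p q => F p.1 p.2.1 p.2.2.1 p.2.2.2 q.1 q.2)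
  simpa only [Fintype.sum_prod_type] using h

theorem star2_raise (hsymm : ∀ a b, ginv G y a b = ginv G y b a) (η : Fin 4 → Fin 4 → ℝ)
    (n m : Fin 4) :
    ∑ i, ∑ j, ginv G y n i * ginv G y m j * star2 G y η i j =
      (1 / 2) * (√(G y).det * (G y)⁻¹.det) *
        ∑ k, ∑ l, leviCivitaSymbol n m k l * η k l := by
  have h : ∀ k l, (G y)⁻¹.det * leviCivitaSymbol n m k l = ∑ i, ∑ j, ∑ a, ∑ b,
      ginv G y n i * ginv G y m j * ginv G y k a * ginv G y l b * leviCivitaSymbol i j a b :=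
    fun k l => (sum_mul_leviCivitaSymbol_four (G y)⁻¹ n m k l).symm
  have h2 : ∑ k, ∑ l, leviCivitaSymbol n m k l * η k l * (G y)⁻¹.det =
      ∑ k, ∑ l, ∑ i, ∑ j, ∑ a, ∑ b, ginv G y n i * ginv G y m j * ginv G y k a * ginv G y l b *
        leviCivitaSymbol i j a b * η k l := by
    refine Finset.sum_congr rfl fun k _ => Finset.sum_congr rfl fun l _ => ?_
    rw [mul_right_comm, mul_comm (leviCivitaSymbol _ _ _ _), h]
    simp only [Finset.sum_mul]
  calc _ = (1 / 2) * √(G y).det * ∑ k, ∑ l, ∑ i, ∑ j, ∑ a, ∑ b, ginv G y n i * ginv G y m j *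
        ginv G y k a * ginv G y l b * leviCivitaSymbol i j a b * η k l := by
        rw [← sum_comm_four_two]
        simp only [Finset.mul_sum, star2, volForm]
        refine Finset.sum_congr rfl fun i _ => Finset.sum_congr rfl fun j _ =>
          Finset.sum_congr rfl fun a _ => Finset.sum_congr rfl fun b _ =>
          Finset.sum_congr rfl fun k _ => Finset.sum_congr rfl fun l _ => ?_
        rw [hsymm a k, hsymm b l]
        ring
    _ = _ := by
        rw [← h2]
        simp only [Finset.mul_sum]
        refine Finset.sum_congr rfl fun k _ => Finset.sum_congr rfl fun l _ => ?_
        ring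

theorem star2_swap (η : Fin 4 → Fin 4 → ℝ) (i j : Fin 4) :
    star2 G y η j i = -star2 G y η i j := by
  simp only [star2, volForm, leviCivitaSymbol_swap_left i j, mul_neg, neg_mul,
    Finset.sum_neg_distrib]

/-- A tensor that is self-dual in its last two indices and has zero divergence-type contraction
has zero exterior-derivative-type cyclic sum. -/
theorem cyclic_sum_eq_zero (hsymm : ∀ a b, ginv G y a b = ginv G y b a) (hdet : 0 < (G y).det)
    {T : Fin 4 → Fin 4 → Fin 4 → ℝ} (hT : ∀ m i j, star2 G y (T m) i j = T m i j)
    (htr : ∀ j, ∑ i, ∑ m, ginv G y i m * T m i j = 0) (m i j : Fin 4) :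
    T m i j + T i j m + T j m i = 0 := by
  have hs : ∀ m i j, T m j i = -T m i j := fun m i j => by
    rw [← hT m j i, star2_swap, hT]
  refine cyclic_sum_eq_zero_of_contraction hs (fun n => ?_) m i j
  have hdet' : (G y)⁻¹.det ≠ 0 := by
    rw [Matrix.det_nonsing_inv, Ring.inverse_eq_inv']
    exact inv_ne_zero hdet.ne'
  have hc : (1 / 2) * (√(G y).det * (G y)⁻¹.det) ≠ 0 :=
    mul_ne_zero (by norm_num) (mul_ne_zero (Real.sqrt_pos.2 hdet).ne' hdet')
  refine (mul_eq_zero.1 ?_).resolve_left hc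
  rw [Finset.mul_sum]
  calc _ = ∑ m, ∑ i, ∑ j, ginv G y n i * ginv G y m j * T m i j := by
        refine Finset.sum_congr rfl fun m _ => ?_
        rw [← star2_raise hsymm (T m) n m]
        simp only [hT]
    _ = ∑ i, ∑ m, ∑ j, ginv G y n i * ginv G y m j * T m i j := Finset.sum_comm
    _ = ∑ i, ginv G y n i * -∑ j, ∑ m, ginv G y j m * T m j i := by
        refine Finset.sum_congr rfl fun i _ => ?_
        rw [Finset.sum_comm]
        simp only [← Finset.sum_neg_distrib, Finset.mul_sum]
        refine Finset.sum_congr rfl fun j _ => Finset.sum_congr rfl fun m _ => ?_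
        rw [hs m j i, hsymm m j]
        ring
    _ = 0 := by simp [htr]

theorem star2_congr {η θ : Fin 4 → Fin 4 → ℝ} (h : ∀ i j, η i j = θ i j) (i j : Fin 4) :
    star2 G y η i j = star2 G y θ i j := by
  simp only [star2, h]

theorem star2_add (η θ : Fin 4 → Fin 4 → ℝ) (i j : Fin 4) :
    star2 G y (fun p q => η p q + θ p q) i j = star2 G y η i j + star2 G y θ i j := by
  simp only [star2, mul_add, Finset.sum_add_distrib]

theorem star2_mul_left (c : ℝ) (η : Fin 4 → Fin 4 → ℝ) (i j : Fin 4) :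
    star2 G y (fun p q => c * η p q) i j = c * star2 G y η i j := by
  simp only [star2, Finset.mul_sum]
  refine Finset.sum_congr rfl fun _ _ => Finset.sum_congr rfl fun _ _ =>
    Finset.sum_congr rfl fun _ _ => Finset.sum_congr rfl fun _ _ => ?_
  ring

theorem star2_sub (η θ : Fin 4 → Fin 4 → ℝ) (i j : Fin 4) :
    star2 G y (fun p q => η p q - θ p q) i j = star2 G y η i j - star2 G y θ i j := by
  simp only [star2, mul_sub, Finset.sum_sub_distrib]

theorem star2_sum {ι : Type*} (s : Finset ι) (η : ι → Fin 4 → Fin 4 → ℝ) (i j : Fin 4) :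
    star2 G y (fun p q => ∑ a ∈ s, η a p q) i j = ∑ a ∈ s, star2 G y (η a) i j := by
  classical
  induction s using Finset.induction_on with
  | empty => simp [star2]
  | insert a s ha ih =>
    simp only [Finset.sum_insert ha]
    rw [star2_add, ih]

end Algebra

section Calculus

open scoped Matrix

theorem pd_congr {f g : E4 → ℝ} {Ω : Set E4} (hΩ : IsOpen Ω) (h : ∀ x ∈ Ω, f x = g x) (m : Fin 4)
    {y : E4} (hy : y ∈ Ω) : pd m f y = pd m g y := by
  have : f =ᶠ[nhds y] g := Filter.eventuallyEq_of_mem (hΩ.mem_nhds hy) h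
  rw [pd, pd, this.fderiv_eq]

theorem pd_const (m : Fin 4) (c : ℝ) (y : E4) : pd m (fun _ => c) y = 0 := by
  simp [pd]

theorem pd_neg (m : Fin 4) (f : E4 → ℝ) (y : E4) : pd m (fun x => -f x) y = -pd m f y := by
  simp [pd, fderiv_fun_neg]

theorem pd_add {f g : E4 → ℝ} {y : E4} (m : Fin 4) (hf : DifferentiableAt ℝ f y)
    (hg : DifferentiableAt ℝ g y) : pd m (fun x => f x + g x) y = pd m f y + pd m g y := by
  simp [pd, fderiv_fun_add hf hg]

theorem pd_sum {ι : Type*} {s : Finset ι} {f : ι → E4 → ℝ} {y : E4} (m : Fin 4)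
    (hf : ∀ i ∈ s, DifferentiableAt ℝ (f i) y) :
    pd m (fun x => ∑ i ∈ s, f i x) y = ∑ i ∈ s, pd m (f i) y := by
  simp only [pd]
  rw [fderiv_fun_sum hf]
  simp

theorem pd_mul {f g : E4 → ℝ} {y : E4} (m : Fin 4) (hf : DifferentiableAt ℝ f y)
    (hg : DifferentiableAt ℝ g y) :
    pd m (fun x => f x * g x) y = pd m f y * g y + f y * pd m g y := by
  simp [pd, fderiv_fun_mul hf hg]
  ring

theorem pd_const_mul {f : E4 → ℝ} {y : E4} (m : Fin 4) (c : ℝ) (hf : DifferentiableAt ℝ f y) :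
    pd m (fun x => c * f x) y = c * pd m f y := by
  rw [pd_mul m (differentiableAt_const c) hf, pd_const]
  ring

theorem contDiffOn_pd {f : E4 → ℝ} {Ω : Set E4} (hΩ : IsOpen Ω) (hf : ContDiffOn ℝ ∞ f Ω)
    (m : Fin 4) : ContDiffOn ℝ ∞ (pd m f) Ω := by
  have h : ContDiffOn ℝ ∞ (fderiv ℝ f) Ω := hf.fderiv_of_isOpen hΩ (by simp)
  exact h.clm_apply contDiffOn_const

theorem differentiableAt_of_contDiffOn {f : E4 → ℝ} {Ω : Set E4} (hΩ : IsOpen Ω)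
    (hf : ContDiffOn ℝ ∞ f Ω) {y : E4} (hy : y ∈ Ω) : DifferentiableAt ℝ f y :=
  (hf.contDiffAt (hΩ.mem_nhds hy)).differentiableAt (by simp)

theorem contDiffOn_det {n : ℕ} {F : E4 → Matrix (Fin n) (Fin n) ℝ} {Ω : Set E4}
    (hF : ∀ a b, ContDiffOn ℝ ∞ (fun x => F x a b) Ω) :
    ContDiffOn ℝ ∞ (fun x => (F x).det) Ω := by
  simp only [Matrix.det_apply']
  exact ContDiffOn.sum fun σ _ => contDiffOn_const.mul (contDiffOn_prod fun i _ => hF _ _)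

/-- The matrix of partial derivatives of a matrix-valued function. -/
def pdMatrix (m : Fin 4) (F : E4 → Matrix (Fin 4) (Fin 4) ℝ) (y : E4) :
    Matrix (Fin 4) (Fin 4) ℝ := Matrix.of fun a b => pd m (fun x => F x a b) y

theorem pdMatrix_mul {F K : E4 → Matrix (Fin 4) (Fin 4) ℝ} {y : E4} (m : Fin 4)
    (hF : ∀ a b, DifferentiableAt ℝ (fun x => F x a b) y)
    (hK : ∀ a b, DifferentiableAt ℝ (fun x => K x a b) y) :
    pdMatrix m (fun x => F x * K x) y = pdMatrix m F y * K y + F y * pdMatrix m K y := by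
  ext a b
  simp only [pdMatrix, Matrix.of_apply, Matrix.add_apply, Matrix.mul_apply]
  rw [pd_sum m fun c _ => (hF a c).fun_mul (hK c b), ← Finset.sum_add_distrib]
  exact Finset.sum_congr rfl fun c _ => pd_mul m (hF a c) (hK c b)

/-- Jacobi's formula. -/
theorem pd_det {F : E4 → Matrix (Fin 4) (Fin 4) ℝ} {y : E4} (m : Fin 4)
    (hF : ∀ a b, DifferentiableAt ℝ (fun x => F x a b) y) :
    pd m (fun x => (F x).det) y = ((F y).adjugate * pdMatrix m F y).trace := by
  have h1 : pd m (fun x => (F x).det) y =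
      ∑ s, ((F y)ᵀ.updateRow s ((pdMatrix m F y)ᵀ s)).det := by
    have hT : ∀ s, ((F y)ᵀ.updateRow s ((pdMatrix m F y)ᵀ s)).det =
        ((F y).updateCol s ((pdMatrix m F y)ᵀ s)).det := fun s => by
      rw [Matrix.updateRow_transpose, Matrix.det_transpose]
    simp only [hT, Matrix.det_apply']
    have hp : ∀ σ : Equiv.Perm (Fin 4), HasFDerivAt (fun x => ∏ i, F x (σ i) i)
        (∑ i, (∏ j ∈ Finset.univ.erase i, F y (σ j) j) • fderiv ℝ (fun x => F x (σ i) i) y) y :=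
      fun σ => HasFDerivAt.finsetProd fun i _ => (hF (σ i) i).hasFDerivAt
    rw [pd_sum m (fun σ _ => (differentiableAt_const _).fun_mul (hp σ).differentiableAt),
      Finset.sum_comm]
    refine Finset.sum_congr rfl fun σ _ => ?_
    rw [pd_const_mul m _ (hp σ).differentiableAt, pd, (hp σ).fderiv, sum_apply, Finset.mul_sum]
    refine Finset.sum_congr rfl fun s _ => ?_
    rw [← Finset.mul_prod_erase Finset.univ _ (Finset.mem_univ s), Matrix.updateCol_self,
      Finset.prod_congr rfl fun i hi => Matrix.updateCol_ne (Finset.ne_of_mem_erase hi)]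
    simp [pdMatrix, pd, mul_comm]
  rw [h1, sum_det_updateRow, ← Matrix.adjugate_transpose, ← Matrix.transpose_mul,
    Matrix.trace_transpose]

/-- A smooth Riemannian metric on an open subset of the model space. -/
structure IsLocalMetric (G : E4 → Matrix (Fin 4) (Fin 4) ℝ) (Ω : Set E4) : Prop where
  isOpen : IsOpen Ω
  smooth : ∀ a b, ContDiffOn ℝ ∞ (fun x => G x a b) Ω
  symm : ∀ x ∈ Ω, ∀ a b, G x a b = G x b a
  det_pos : ∀ x ∈ Ω, 0 < (G x).det

variable {G : E4 → Matrix (Fin 4) (Fin 4) ℝ} {Ω : Set E4} {y : E4}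

/-- The matrix `Γ^c_{ma}` with rows `c` and columns `a`. -/
def chMatrix (G : E4 → Matrix (Fin 4) (Fin 4) ℝ) (y : E4) (m : Fin 4) :
    Matrix (Fin 4) (Fin 4) ℝ := Matrix.of fun c a => christoffel G y c m a

namespace IsLocalMetric

variable (hG : IsLocalMetric G Ω)
include hG

theorem diffAt {f : E4 → ℝ} (hf : ContDiffOn ℝ ∞ f Ω) (hy : y ∈ Ω) : DifferentiableAt ℝ f y :=
  differentiableAt_of_contDiffOn hG.isOpen hf hy

theorem smooth_ginv (a b : Fin 4) : ContDiffOn ℝ ∞ (fun x => ginv G x a b) Ω := by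
  have h : (fun x => ginv G x a b) =
      fun x => (G x).det⁻¹ * ((G x).updateRow b (Pi.single a 1)).det := by
    ext x
    rw [ginv, Matrix.inv_def, Matrix.smul_apply, Matrix.adjugate_apply, Ring.inverse_eq_inv',
      smul_eq_mul]
  rw [h]
  refine ((contDiffOn_det hG.smooth).inv fun x hx => (hG.det_pos x hx).ne').mul
    (contDiffOn_det fun c d => ?_)
  by_cases hc : c = b
  · subst hc; simpa using contDiffOn_const
  · simpa [hc] using hG.smooth c d

theorem smooth_christoffel (c a b : Fin 4) : ContDiffOn ℝ ∞ (fun x => christoffel G x c a b) Ω :=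
  contDiffOn_const.mul <| ContDiffOn.sum fun d _ => (hG.smooth_ginv c d).mul
    (((contDiffOn_pd hG.isOpen (hG.smooth b d) a).add
      (contDiffOn_pd hG.isOpen (hG.smooth a d) b)).sub (contDiffOn_pd hG.isOpen (hG.smooth a b) d))

theorem smooth_sqrt_det : ContDiffOn ℝ ∞ (fun x => √(G x).det) Ω :=
  (contDiffOn_det hG.smooth).sqrt fun x hx => (hG.det_pos x hx).ne'

theorem smooth_volForm (i j k l : Fin 4) : ContDiffOn ℝ ∞ (fun x => volForm G x i j k l) Ω :=
  hG.smooth_sqrt_det.mul contDiffOn_const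

theorem mul_inv (hy : y ∈ Ω) : G y * (G y)⁻¹ = 1 :=
  Matrix.mul_nonsing_inv _ (hG.det_pos y hy).ne'.isUnit

theorem inv_mul (hy : y ∈ Ω) : (G y)⁻¹ * G y = 1 :=
  Matrix.nonsing_inv_mul _ (hG.det_pos y hy).ne'.isUnit

theorem transpose_eq (hy : y ∈ Ω) : (G y)ᵀ = G y := by
  ext a b
  exact hG.symm y hy b a

theorem ginv_symm (hy : y ∈ Ω) (a b : Fin 4) : ginv G y a b = ginv G y b a := by
  have h : ((G y)⁻¹)ᵀ = (G y)⁻¹ := by rw [Matrix.transpose_nonsing_inv, hG.transpose_eq hy]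
  exact congrFun (congrFun h b) a

theorem mul_chMatrix (hy : y ∈ Ω) (m a b : Fin 4) : (G y * chMatrix G y m) a b =
    (1 / 2) * (pd m (fun x => G x b a) y + pd b (fun x => G x m a) y
      - pd a (fun x => G x m b) y) := by
  have h : chMatrix G y m = (G y)⁻¹ * Matrix.of fun d b => (1 / 2) *
      (pd m (fun x => G x b d) y + pd b (fun x => G x m d) y - pd d (fun x => G x m b) y) := by
    ext c b
    simp only [chMatrix, christoffel, ginv, Matrix.of_apply, Matrix.mul_apply, Finset.mul_sum]
    exact Finset.sum_congr rfl fun _ _ => by ring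
  rw [h, ← Matrix.mul_assoc, hG.mul_inv hy, Matrix.one_mul, Matrix.of_apply]

/-- The Levi-Civita connection is metric. -/
theorem pdMatrix_metric (hy : y ∈ Ω) (m : Fin 4) :
    pdMatrix m G y = (chMatrix G y m)ᵀ * G y + G y * chMatrix G y m := by
  have h : (chMatrix G y m)ᵀ * G y = (G y * chMatrix G y m)ᵀ := by
    rw [Matrix.transpose_mul, hG.transpose_eq hy]
  have hs : ∀ n a b, pd n (fun x => G x a b) y = pd n (fun x => G x b a) y := fun n a b =>
    pd_congr hG.isOpen (fun x hx => hG.symm x hx a b) n hy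
  ext a b
  rw [h, Matrix.add_apply, Matrix.transpose_apply, hG.mul_chMatrix hy, hG.mul_chMatrix hy,
    pdMatrix, Matrix.of_apply, hs m b a]
  ring

theorem pdMatrix_inv (hy : y ∈ Ω) (m : Fin 4) :
    pdMatrix m (fun x => (G x)⁻¹) y =
      -(chMatrix G y m * (G y)⁻¹ + (G y)⁻¹ * (chMatrix G y m)ᵀ) := by
  have h1 : pdMatrix m (fun x => G x * (G x)⁻¹) y = 0 := by
    ext a b
    simp only [pdMatrix, Matrix.of_apply, Matrix.zero_apply]
    rw [pd_congr hG.isOpen (g := fun _ => (1 : Matrix (Fin 4) (Fin 4) ℝ) a b)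
      (fun x hx => by rw [hG.mul_inv hx]) m hy, pd_const]
  rw [pdMatrix_mul (F := G) (K := fun x => (G x)⁻¹) m (fun a b => hG.diffAt (hG.smooth a b) hy)
    (fun a b => hG.diffAt (hG.smooth_ginv a b) hy), hG.pdMatrix_metric hy] at h1
  have h2 := congrArg ((G y)⁻¹ * ·) h1
  simp only [Matrix.mul_add, Matrix.add_mul, Matrix.mul_zero, ← Matrix.mul_assoc,
    hG.inv_mul hy, Matrix.one_mul] at h2
  rw [Matrix.mul_assoc _ (G y) (G y)⁻¹, hG.mul_inv hy, Matrix.mul_one] at h2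
  rw [eq_neg_iff_add_eq_zero, ← h2]
  abel

theorem pd_ginv (hy : y ∈ Ω) (m a b : Fin 4) : pd m (fun x => ginv G x a b) y =
    -(∑ c, christoffel G y a m c * ginv G y c b + ∑ c, christoffel G y b m c * ginv G y a c) := by
  have h := congrFun (congrFun (hG.pdMatrix_inv hy m) a) b
  refine h.trans ?_
  simp only [Matrix.neg_apply, Matrix.add_apply, Matrix.mul_apply, Matrix.transpose_apply,
    chMatrix, Matrix.of_apply, ginv, mul_comm]

theorem pd_sqrt_det (hy : y ∈ Ω) (m : Fin 4) :
    pd m (fun x => √(G x).det) y = (chMatrix G y m).trace * √(G y).det := by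
  have hd := hG.det_pos y hy
  have h1 : pd m (fun x => √(G x).det) y = pd m (fun x => (G x).det) y / (2 * √(G y).det) := by
    have := (hG.diffAt (contDiffOn_det hG.smooth) hy).hasFDerivAt.sqrt hd.ne'
    rw [pd, this.fderiv, pd]
    simp [div_eq_inv_mul]
  have h2 : (G y).adjugate = (G y).det • (G y)⁻¹ := by
    rw [Matrix.inv_def, smul_smul, Ring.mul_inverse_cancel _ hd.ne'.isUnit, one_smul]
  rw [h1, pd_det m (fun a b => hG.diffAt (hG.smooth a b) hy), h2, hG.pdMatrix_metric hy,
    Matrix.smul_mul, Matrix.mul_add, Matrix.trace_smul, Matrix.trace_add, ← Matrix.mul_assoc _ (G y),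
    hG.inv_mul hy, Matrix.one_mul, Matrix.trace_mul_comm, Matrix.mul_assoc, hG.mul_inv hy,
    Matrix.mul_one, Matrix.trace_transpose, smul_eq_mul,
    div_eq_iff (mul_ne_zero two_ne_zero (Real.sqrt_pos.2 hd).ne')]
  linear_combination (-2 * (chMatrix G y m).trace) * Real.mul_self_sqrt hd.le

/-- The volume form is parallel. -/
theorem pd_volForm (hy : y ∈ Ω) (m i j k l : Fin 4) :
    pd m (fun x => volForm G x i j k l) y =
      ∑ c, christoffel G y c m i * volForm G y c j k l
      + ∑ c, christoffel G y c m j * volForm G y i c k l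
      + ∑ c, christoffel G y c m k * volForm G y i j c l
      + ∑ c, christoffel G y c m l * volForm G y i j k c := by
  have h := sum_mul_leviCivitaSymbol (chMatrix G y m)ᵀ i j k l
  have h2 : pd m (fun x => volForm G x i j k l) y =
      √(G y).det * ((chMatrix G y m).trace * leviCivitaSymbol i j k l) := by
    simp only [volForm]
    rw [pd_mul m (hG.diffAt hG.smooth_sqrt_det hy) (differentiableAt_const _), pd_const,
      hG.pd_sqrt_det hy]
    ring
  rw [h2, ← Matrix.trace_transpose, ← h]
  simp only [mul_add, Finset.mul_sum, volForm, Matrix.transpose_apply, chMatrix, Matrix.of_apply,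
    mul_left_comm]

/-- The Hodge star on two-forms is parallel. -/
theorem pd_star2 {η : E4 → Fin 4 → Fin 4 → ℝ} (hη : ∀ i j, DifferentiableAt ℝ (fun x => η x i j) y)
    (hy : y ∈ Ω) (m i j : Fin 4) :
    star2 G y (fun p q => pd m (fun x => η x p q) y - ∑ c, christoffel G y c m p * η y c q
        - ∑ c, christoffel G y c m q * η y p c) i j =
      pd m (fun x => star2 G x (η x) i j) y
        - ∑ c, christoffel G y c m i * star2 G y (η y) c j
        - ∑ c, christoffel G y c m j * star2 G y (η y) i c := by
  let up : E4 → Matrix (Fin 4) (Fin 4) ℝ := fun x => (G x)⁻¹ * Matrix.of (η x) * ((G x)⁻¹)ᵀ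
  have hstar : ∀ x θ p q, star2 G x θ p q = (1 / 2) * ∑ a, ∑ b, volForm G x p q a b *
      ((G x)⁻¹ * Matrix.of θ * ((G x)⁻¹)ᵀ) a b := by
    intro x θ p q
    simp only [star2, Matrix.mul_apply, Matrix.transpose_apply, Matrix.of_apply, Finset.mul_sum,
      Finset.sum_mul, ginv]
    refine Finset.sum_congr rfl fun a _ => Finset.sum_congr rfl fun b _ => ?_
    rw [Finset.sum_comm]
    refine Finset.sum_congr rfl fun k _ => Finset.sum_congr rfl fun l _ => ?_
    ring
  have hinv : ∀ a b, DifferentiableAt ℝ (fun x => (G x)⁻¹ a b) y :=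
    fun a b => hG.diffAt (hG.smooth_ginv a b) hy
  have hmul : ∀ {F K : E4 → Matrix (Fin 4) (Fin 4) ℝ},
      (∀ a b, DifferentiableAt ℝ (fun x => F x a b) y) →
      (∀ a b, DifferentiableAt ℝ (fun x => K x a b) y) →
      ∀ a b, DifferentiableAt ℝ (fun x => (F x * K x) a b) y := by
    intro F K hF hK a b
    simp only [Matrix.mul_apply]
    exact DifferentiableAt.fun_sum fun c _ => (hF a c).fun_mul (hK c b)
  have hup : ∀ a b, DifferentiableAt ℝ (fun x => up x a b) y :=
    hmul (hmul hinv hη) fun a b => hinv b a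
  have hvol : ∀ a b, DifferentiableAt ℝ (fun x => volForm G x i j a b) y :=
    fun a b => hG.diffAt (hG.smooth_volForm i j a b) hy
  have hD : (G y)⁻¹ * Matrix.of (fun p q => pd m (fun x => η x p q) y
        - ∑ c, christoffel G y c m p * η y c q - ∑ c, christoffel G y c m q * η y p c)
        * ((G y)⁻¹)ᵀ =
      pdMatrix m up y + chMatrix G y m * up y + up y * (chMatrix G y m)ᵀ := by
    have h1 : Matrix.of (fun p q => pd m (fun x => η x p q) y
        - ∑ c, christoffel G y c m p * η y c q - ∑ c, christoffel G y c m q * η y p c) =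
        pdMatrix m (fun x => Matrix.of (η x)) y - (chMatrix G y m)ᵀ * Matrix.of (η y)
          - Matrix.of (η y) * chMatrix G y m := by
      ext p q
      simp [pdMatrix, Matrix.mul_apply, chMatrix, mul_comm]
    have h2 : pdMatrix m (fun x => ((G x)⁻¹)ᵀ) y = (pdMatrix m (fun x => (G x)⁻¹) y)ᵀ := rfl
    have h3 : pdMatrix m up y = _ :=
      pdMatrix_mul (F := fun x => (G x)⁻¹ * Matrix.of (η x)) (K := fun x => ((G x)⁻¹)ᵀ) m
        (hmul hinv hη) (fun a b => hinv b a)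
    rw [h1, h3, pdMatrix_mul (F := fun x => (G x)⁻¹) (K := fun x => Matrix.of (η x)) m hinv hη, h2,
      hG.pdMatrix_inv hy]
    simp only [up, Matrix.transpose_neg, Matrix.transpose_add, Matrix.transpose_mul,
      Matrix.transpose_transpose]
    noncomm_ring
  have hpd : pd m (fun x => star2 G x (η x) i j) y = (1 / 2) * ∑ a, ∑ b,
      (pd m (fun x => volForm G x i j a b) y * up y a b
        + volForm G y i j a b * pdMatrix m up y a b) := by
    have hsum : ∀ a, DifferentiableAt ℝ (fun x => ∑ b, volForm G x i j a b * up x a b) y :=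
      fun a => DifferentiableAt.fun_sum fun b _ => (hvol a b).fun_mul (hup a b)
    simp only [hstar]
    rw [pd_const_mul m _ (DifferentiableAt.fun_sum fun a _ => hsum a), pd_sum m fun a _ => hsum a]
    congr 1
    refine Finset.sum_congr rfl fun a _ => ?_
    rw [pd_sum m fun b _ => (hvol a b).fun_mul (hup a b)]
    exact Finset.sum_congr rfl fun b _ => pd_mul m (hvol a b) (hup a b)
  have s1 : ∑ a, ∑ b, ∑ c, volForm G y i j a b * (christoffel G y a m c * up y c b) =
      ∑ a, ∑ b, ∑ c, christoffel G y c m a * volForm G y i j c b * up y a b := by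
    rw [Finset.sum_congr rfl fun a _ => Finset.sum_comm, Finset.sum_comm]
    refine Finset.sum_congr rfl fun a _ => ?_
    rw [Finset.sum_comm]
    refine Finset.sum_congr rfl fun b _ => Finset.sum_congr rfl fun c _ => ?_
    ring
  have s2 : ∑ a, ∑ b, ∑ c, volForm G y i j a b * (up y a c * christoffel G y b m c) =
      ∑ a, ∑ b, ∑ c, christoffel G y c m b * volForm G y i j a c * up y a b := by
    refine Finset.sum_congr rfl fun a _ => ?_
    rw [Finset.sum_comm]
    refine Finset.sum_congr rfl fun b _ => Finset.sum_congr rfl fun c _ => ?_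
    ring
  have s3 : ∑ c, christoffel G y c m i * star2 G y (η y) c j =
      (1 / 2) * ∑ a, ∑ b, ∑ c, christoffel G y c m i * volForm G y c j a b * up y a b := by
    simp only [hstar, Finset.mul_sum]
    rw [Finset.sum_comm]
    refine Finset.sum_congr rfl fun a _ => ?_
    rw [Finset.sum_comm]
    refine Finset.sum_congr rfl fun b _ => Finset.sum_congr rfl fun c _ => ?_
    simp only [up]
    ring
  have s4 : ∑ c, christoffel G y c m j * star2 G y (η y) i c =
      (1 / 2) * ∑ a, ∑ b, ∑ c, christoffel G y c m j * volForm G y i c a b * up y a b := by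
    simp only [hstar, Finset.mul_sum]
    rw [Finset.sum_comm]
    refine Finset.sum_congr rfl fun a _ => ?_
    rw [Finset.sum_comm]
    refine Finset.sum_congr rfl fun b _ => Finset.sum_congr rfl fun c _ => ?_
    simp only [up]
    ring
  rw [hpd, hstar, hD, s3, s4]
  simp only [hG.pd_volForm hy, Matrix.add_apply, Matrix.mul_apply, Matrix.transpose_apply,
    chMatrix, Matrix.of_apply, mul_add, add_mul, Finset.sum_add_distrib, Finset.mul_sum,
    Finset.sum_mul] at s1 s2 ⊢
  simp only [← Finset.mul_sum] at s1 s2 ⊢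
  linarith

end IsLocalMetric

end Calculus

section WeylFields

variable {G : E4 → Matrix (Fin 4) (Fin 4) ℝ} {Ω : Set E4} {y : E4}

theorem cov_four (T : E4 → (Fin 4 → Fin 4) → ℝ) (m i j k l : Fin 4) :
    cov G T y ![m, i, j, k, l] = pd m (fun x => T x ![i, j, k, l]) y
      - ∑ c, christoffel G y c m i * T y ![c, j, k, l]
      - ∑ c, christoffel G y c m j * T y ![i, c, k, l]
      - ∑ c, christoffel G y c m k * T y ![i, j, c, l]
      - ∑ c, christoffel G y c m l * T y ![i, j, k, c] := by
  have u0 : ∀ c, Function.update ![i, j, k, l] 0 c = ![c, j, k, l] := by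
    intro c; ext a; fin_cases a <;> rfl
  have u1 : ∀ c, Function.update ![i, j, k, l] 1 c = ![i, c, k, l] := by
    intro c; ext a; fin_cases a <;> rfl
  have u2 : ∀ c, Function.update ![i, j, k, l] 2 c = ![i, j, c, l] := by
    intro c; ext a; fin_cases a <;> rfl
  have u3 : ∀ c, Function.update ![i, j, k, l] 3 c = ![i, j, k, c] := by
    intro c; ext a; fin_cases a <;> rfl
  have ht : Fin.tail ![m, i, j, k, l] = ![i, j, k, l] := rfl
  rw [cov, ht, Fin.sum_univ_four]
  simp only [u0, u1, u2, u3]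
  simp only [sub_sub, add_assoc]
  rfl

theorem cov_five (T : E4 → (Fin 5 → Fin 4) → ℝ) (m n i j k l : Fin 4) :
    cov G T y ![m, n, i, j, k, l] = pd m (fun x => T x ![n, i, j, k, l]) y
      - ∑ c, christoffel G y c m n * T y ![c, i, j, k, l]
      - ∑ c, christoffel G y c m i * T y ![n, c, j, k, l]
      - ∑ c, christoffel G y c m j * T y ![n, i, c, k, l]
      - ∑ c, christoffel G y c m k * T y ![n, i, j, c, l]
      - ∑ c, christoffel G y c m l * T y ![n, i, j, k, c] := by
  have u0 : ∀ c, Function.update ![n, i, j, k, l] 0 c = ![c, i, j, k, l] := by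
    intro c; ext a; fin_cases a <;> rfl
  have u1 : ∀ c, Function.update ![n, i, j, k, l] 1 c = ![n, c, j, k, l] := by
    intro c; ext a; fin_cases a <;> rfl
  have u2 : ∀ c, Function.update ![n, i, j, k, l] 2 c = ![n, i, c, k, l] := by
    intro c; ext a; fin_cases a <;> rfl
  have u3 : ∀ c, Function.update ![n, i, j, k, l] 3 c = ![n, i, j, c, l] := by
    intro c; ext a; fin_cases a <;> rfl
  have u4 : ∀ c, Function.update ![n, i, j, k, l] 4 c = ![n, i, j, k, c] := by
    intro c; ext a; fin_cases a <;> rfl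
  have ht : Fin.tail ![m, n, i, j, k, l] = ![n, i, j, k, l] := rfl
  rw [cov, ht, Fin.sum_univ_five]
  simp only [u0, u1, u2, u3, u4]
  simp only [sub_sub, add_assoc]
  rfl

theorem sum_contraction_comm (H : Fin 4 → Fin 4 → ℝ) (v : Fin 4 → ℝ)
    (f : Fin 4 → Fin 4 → Fin 4 → ℝ) :
    ∑ a, ∑ b, H a b * ∑ c, v c * f c a b = ∑ c, v c * ∑ a, ∑ b, H a b * f c a b := by
  simp only [Finset.mul_sum]
  rw [Finset.sum_congr rfl fun i _ => Finset.sum_comm, Finset.sum_comm]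
  refine Finset.sum_congr rfl fun c _ => Finset.sum_congr rfl fun i _ =>
    Finset.sum_congr rfl fun k _ => ?_
  ring

namespace IsLocalMetric

variable (hG : IsLocalMetric G Ω)
include hG

theorem smooth_cov {n : ℕ} {T : E4 → (Fin n → Fin 4) → ℝ}
    (hT : ∀ I, ContDiffOn ℝ ∞ (fun x => T x I) Ω) (J : Fin (n + 1) → Fin 4) :
    ContDiffOn ℝ ∞ (fun x => cov G T x J) Ω :=
  (contDiffOn_pd hG.isOpen (hT _) _).sub <| ContDiffOn.sum fun _ _ => ContDiffOn.sum fun _ _ =>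
    (hG.smooth_christoffel _ _ _).mul (hT _)

/-- The metric contraction of two indices is parallel. -/
theorem pd_contraction {t : E4 → Fin 4 → Fin 4 → ℝ}
    (ht : ∀ a b, DifferentiableAt ℝ (fun x => t x a b) y) (hy : y ∈ Ω) (m : Fin 4) :
    pd m (fun x => ∑ a, ∑ b, ginv G x a b * t x a b) y =
      ∑ a, ∑ b, ginv G y a b * (pd m (fun x => t x a b) y
        - ∑ c, christoffel G y c m a * t y c b - ∑ c, christoffel G y c m b * t y a c) := by
  have hg : ∀ a b, DifferentiableAt ℝ (fun x => ginv G x a b) y :=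
    fun a b => hG.diffAt (hG.smooth_ginv a b) hy
  have h1 : pd m (fun x => ∑ a, ∑ b, ginv G x a b * t x a b) y =
      ∑ a, ∑ b, (pd m (fun x => ginv G x a b) y * t y a b
        + ginv G y a b * pd m (fun x => t x a b) y) := by
    rw [pd_sum m fun a _ => DifferentiableAt.fun_sum fun b _ => (hg a b).fun_mul (ht a b)]
    refine Finset.sum_congr rfl fun a _ => ?_
    rw [pd_sum m fun b _ => (hg a b).fun_mul (ht a b)]
    exact Finset.sum_congr rfl fun b _ => pd_mul m (hg a b) (ht a b)
  have s1 : ∑ a, ∑ b, ∑ c, christoffel G y a m c * ginv G y c b * t y a b =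
      ∑ a, ∑ b, ∑ c, ginv G y a b * (christoffel G y c m a * t y c b) := by
    rw [Finset.sum_congr rfl fun a _ => Finset.sum_comm, Finset.sum_comm]
    refine Finset.sum_congr rfl fun a _ => ?_
    rw [Finset.sum_comm]
    refine Finset.sum_congr rfl fun b _ => Finset.sum_congr rfl fun c _ => ?_
    ring
  have s2 : ∑ a, ∑ b, ∑ c, christoffel G y b m c * ginv G y a c * t y a b =
      ∑ a, ∑ b, ∑ c, ginv G y a b * (christoffel G y c m b * t y a c) := by
    refine Finset.sum_congr rfl fun a _ => ?_
    rw [Finset.sum_comm]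
    refine Finset.sum_congr rfl fun b _ => Finset.sum_congr rfl fun c _ => ?_
    ring
  rw [h1]
  simp only [hG.pd_ginv hy, mul_sub, neg_mul, add_mul, Finset.sum_mul, Finset.mul_sum,
    Finset.sum_add_distrib, Finset.sum_sub_distrib, Finset.sum_neg_distrib, s1, s2]
  ring

/-- The covariant derivative of a self-dual two-form is self-dual. -/
theorem star2_covForm {η : E4 → Fin 4 → Fin 4 → ℝ}
    (hη : ∀ i j, ContDiffOn ℝ ∞ (fun x => η x i j) Ω)
    (hsd : ∀ x ∈ Ω, ∀ i j, star2 G x (η x) i j = η x i j) (hy : y ∈ Ω) (m i j : Fin 4) :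
    star2 G y (fun p q => pd m (fun x => η x p q) y - ∑ c, christoffel G y c m p * η y c q
        - ∑ c, christoffel G y c m q * η y p c) i j =
      pd m (fun x => η x i j) y - ∑ c, christoffel G y c m i * η y c j
        - ∑ c, christoffel G y c m j * η y i c := by
  rw [hG.pd_star2 (fun i j => hG.diffAt (hη i j) hy) hy,
    pd_congr hG.isOpen (fun x hx => hsd x hx i j) m hy]
  simp only [hsd y hy]

end IsLocalMetric

/-- A smooth self-dual Weyl-type tensor field in local coordinates. -/
structure IsLocalSDWeyl (G : E4 → Matrix (Fin 4) (Fin 4) ℝ) (Ω : Set E4)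
    (U : E4 → (Fin 4 → Fin 4) → ℝ) : Prop where
  smooth : ∀ I, ContDiffOn ℝ ∞ (fun x => U x I) Ω
  skew_left : ∀ x ∈ Ω, ∀ i j k l, U x ![j, i, k, l] = -U x ![i, j, k, l]
  skew_right : ∀ x ∈ Ω, ∀ i j k l, U x ![i, j, l, k] = -U x ![i, j, k, l]
  pair_symm : ∀ x ∈ Ω, ∀ i j k l, U x ![k, l, i, j] = U x ![i, j, k, l]
  bianchi : ∀ x ∈ Ω, ∀ i j k l, U x ![i, j, k, l] + U x ![j, k, i, l] + U x ![k, i, j, l] = 0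
  trace_free : ∀ x ∈ Ω, ∀ j l, ∑ i, ∑ k, ginv G x i k * U x ![i, j, k, l] = 0
  self_dual : ∀ x ∈ Ω, ∀ i j k l,
    star2 G x (fun p q => U x ![p, q, k, l]) i j = U x ![i, j, k, l]

namespace IsLocalSDWeyl

variable {U : E4 → (Fin 4 → Fin 4) → ℝ} (hG : IsLocalMetric G Ω) (hU : IsLocalSDWeyl G Ω U)
include hG hU

theorem cov_skew_left (hy : y ∈ Ω) (m i j k l : Fin 4) :
    cov G U y ![m, j, i, k, l] = -cov G U y ![m, i, j, k, l] := by
  rw [cov_four, cov_four, pd_congr hG.isOpen (fun x hx => hU.skew_left x hx i j k l) m hy, pd_neg]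
  have h1 := fun c => hU.skew_left y hy c j k l
  have h2 := fun c => hU.skew_left y hy i c k l
  have h3 := fun c => hU.skew_left y hy i j c l
  have h4 := fun c => hU.skew_left y hy i j k c
  simp only [h1, h2, h3, h4, mul_neg, Finset.sum_neg_distrib]
  ring

theorem cov_pair_symm (hy : y ∈ Ω) (m i j k l : Fin 4) :
    cov G U y ![m, k, l, i, j] = cov G U y ![m, i, j, k, l] := by
  rw [cov_four, cov_four, pd_congr hG.isOpen (fun x hx => hU.pair_symm x hx i j k l) m hy]
  have h1 := fun c => hU.pair_symm y hy c j k l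
  have h2 := fun c => hU.pair_symm y hy i c k l
  have h3 := fun c => hU.pair_symm y hy i j c l
  have h4 := fun c => hU.pair_symm y hy i j k c
  simp only [h1, h2, h3, h4]
  ring

theorem cov_bianchi (hy : y ∈ Ω) (m i j k l : Fin 4) :
    cov G U y ![m, i, j, k, l] + cov G U y ![m, j, k, i, l] + cov G U y ![m, k, i, j, l] = 0 := by
  have hd : ∀ I, DifferentiableAt ℝ (fun x => U x I) y := fun I => hG.diffAt (hU.smooth I) hy
  have h0 := pd_congr hG.isOpen (fun x hx => hU.bianchi x hx i j k l) m hy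
  rw [pd_add m ((hd _).fun_add (hd _)) (hd _), pd_add m (hd _) (hd _), pd_const] at h0
  rw [cov_four, cov_four, cov_four]
  have key : ∀ u : Fin 4, ∀ f g h : Fin 4 → ℝ, (∀ c, f c + g c + h c = 0) →
      ∑ c, christoffel G y c m u * f c + ∑ c, christoffel G y c m u * g c
        + ∑ c, christoffel G y c m u * h c = 0 := by
    intro u f g h hf
    rw [← Finset.sum_add_distrib, ← Finset.sum_add_distrib]
    refine Finset.sum_eq_zero fun c _ => ?_
    rw [← mul_add, ← mul_add, hf, mul_zero]
  have k1 := key i _ _ _ fun c => hU.bianchi y hy c j k l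
  have k2 := key j _ _ _ fun c => hU.bianchi y hy i c k l
  have k3 := key k _ _ _ fun c => hU.bianchi y hy i j c l
  have k4 := key l _ _ _ fun c => hU.bianchi y hy i j k c
  linarith

theorem cov_trace_free (hy : y ∈ Ω) (m j l : Fin 4) :
    ∑ i, ∑ k, ginv G y i k * cov G U y ![m, i, j, k, l] = 0 := by
  have h0 := hG.pd_contraction (t := fun x i k => U x ![i, j, k, l])
    (fun a b => hG.diffAt (hU.smooth _) hy) hy m
  rw [pd_congr hG.isOpen (fun x hx => hU.trace_free x hx j l) m hy, pd_const] at h0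
  have hz : ∀ u (f : Fin 4 → Fin 4 → Fin 4 → ℝ), (∀ c, ∑ i, ∑ k, ginv G y i k * f c i k = 0) →
      ∑ i, ∑ k, ginv G y i k * ∑ c, christoffel G y c m u * f c i k = 0 := by
    intro u f hf
    simp only [sum_contraction_comm, hf, mul_zero, Finset.sum_const_zero]
  have z1 := hz j (fun c i k => U y ![i, c, k, l]) fun c => hU.trace_free y hy c l
  have z2 := hz l (fun c i k => U y ![i, j, k, c]) fun c => hU.trace_free y hy j c
  simp only [cov_four, mul_sub, Finset.sum_sub_distrib] at h0 ⊢
  linarith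

theorem cov_self_dual (hy : y ∈ Ω) (m i j k l : Fin 4) :
    star2 G y (fun p q => cov G U y ![m, p, q, k, l]) i j = cov G U y ![m, i, j, k, l] := by
  simp only [cov_four]
  rw [star2_sub, star2_sub, hG.star2_covForm (η := fun x p q => U x ![p, q, k, l])
    (fun _ _ => hU.smooth _) (fun x hx i j => hU.self_dual x hx i j k l) hy, star2_sum, star2_sum]
  simp only [star2_mul_left, hU.self_dual y hy]

theorem cov_cov_skew_left (hy : y ∈ Ω) (m n i j k l : Fin 4) :
    cov G (cov G U) y ![m, n, j, i, k, l] = -cov G (cov G U) y ![m, n, i, j, k, l] := by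
  rw [cov_five, cov_five,
    pd_congr hG.isOpen (fun x hx => hU.cov_skew_left hG hx n i j k l) m hy, pd_neg]
  have h0 := fun c => hU.cov_skew_left hG hy c i j k l
  have h1 := fun c => hU.cov_skew_left hG hy n c j k l
  have h2 := fun c => hU.cov_skew_left hG hy n i c k l
  have h3 := fun c => hU.cov_skew_left hG hy n i j c l
  have h4 := fun c => hU.cov_skew_left hG hy n i j k c
  simp only [h0, h1, h2, h3, h4, mul_neg, Finset.sum_neg_distrib]
  ring

theorem cov_cov_pair_symm (hy : y ∈ Ω) (m n i j k l : Fin 4) :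
    cov G (cov G U) y ![m, n, k, l, i, j] = cov G (cov G U) y ![m, n, i, j, k, l] := by
  rw [cov_five, cov_five,
    pd_congr hG.isOpen (fun x hx => hU.cov_pair_symm hG hx n i j k l) m hy]
  have h0 := fun c => hU.cov_pair_symm hG hy c i j k l
  have h1 := fun c => hU.cov_pair_symm hG hy n c j k l
  have h2 := fun c => hU.cov_pair_symm hG hy n i c k l
  have h3 := fun c => hU.cov_pair_symm hG hy n i j c l
  have h4 := fun c => hU.cov_pair_symm hG hy n i j k c
  simp only [h0, h1, h2, h3, h4]
  ring

theorem smooth_div4 (k i j : Fin 4) : ContDiffOn ℝ ∞ (fun x => div4 G U x k i j) Ω :=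
  ContDiffOn.sum fun m _ => ContDiffOn.sum fun n _ =>
    (hG.smooth_ginv m n).mul (hG.smooth_cov hU.smooth _)

theorem div4_self_dual (hy : y ∈ Ω) (k i j : Fin 4) :
    star2 G y (fun p q => div4 G U y k p q) i j = div4 G U y k i j := by
  simp only [div4]
  rw [star2_sum]
  refine Finset.sum_congr rfl fun a _ => ?_
  rw [star2_sum]
  refine Finset.sum_congr rfl fun b _ => ?_
  rw [star2_mul_left, ← hU.cov_pair_symm hG hy b a k i j, ← hU.cov_self_dual hG hy b i j a k]
  exact congrArg _ (star2_congr (fun p q => (hU.cov_pair_symm hG hy b p q a k)) i j)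

theorem div4_bianchi (hy : y ∈ Ω) (j k l : Fin 4) :
    div4 G U y j k l + div4 G U y k l j + div4 G U y l j k = 0 := by
  simp only [div4, ← Finset.sum_add_distrib, ← mul_add]
  refine Finset.sum_eq_zero fun a _ => Finset.sum_eq_zero fun b _ => ?_
  have h := hU.cov_bianchi hG hy b j k l a
  rw [← hU.cov_pair_symm hG hy b j k l a, ← hU.cov_pair_symm hG hy b k l j a,
    ← hU.cov_pair_symm hG hy b l j k a, hU.cov_skew_left hG hy b a l j k,
    hU.cov_skew_left hG hy b a j k l, hU.cov_skew_left hG hy b a k l j] at h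
  rw [show cov G U y ![b, a, j, k, l] + cov G U y ![b, a, k, l, j] + cov G U y ![b, a, l, j, k] = 0
    by linarith, mul_zero]

theorem div4_trace_free (hy : y ∈ Ω) (j : Fin 4) :
    ∑ i, ∑ m, ginv G y i m * div4 G U y m i j = 0 := by
  have h : ∀ a b, ∑ i, ∑ m, ginv G y i m * cov G U y ![b, a, m, i, j] = 0 := by
    intro a b
    rw [← neg_eq_zero, ← hU.cov_trace_free hG hy b a j, Finset.sum_comm]
    simp only [← Finset.sum_neg_distrib]
    refine Finset.sum_congr rfl fun i _ => Finset.sum_congr rfl fun m _ => ?_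
    rw [hU.cov_skew_left hG hy b i a m j, hG.ginv_symm hy m i]
    ring
  calc _ = ∑ a, ∑ b, ginv G y a b * ∑ i, ∑ m, ginv G y i m * cov G U y ![b, a, m, i, j] := by
        simp only [div4, Finset.mul_sum]
        have h2 := Finset.sum_comm (s := (Finset.univ : Finset (Fin 4 × Fin 4)))
          (t := (Finset.univ : Finset (Fin 4 × Fin 4)))
          (f := fun p q => ginv G y p.1 p.2 * (ginv G y q.1 q.2 *
            cov G U y ![q.2, q.1, p.2, p.1, j]))
        simp only [Fintype.sum_prod_type] at h2
        rw [h2]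
        refine Finset.sum_congr rfl fun a _ => Finset.sum_congr rfl fun b _ =>
          Finset.sum_congr rfl fun i _ => Finset.sum_congr rfl fun m _ => ?_
        ring
    _ = 0 := by simp only [h, mul_zero, Finset.sum_const_zero]

theorem pd_div4 (hy : y ∈ Ω) (m k i j : Fin 4) :
    pd m (fun x => div4 G U x k i j) y - ∑ c, christoffel G y c m k * div4 G U y c i j
        - ∑ c, christoffel G y c m i * div4 G U y k c j
        - ∑ c, christoffel G y c m j * div4 G U y k i c =
      ∑ a, ∑ b, ginv G y a b * cov G (cov G U) y ![m, b, a, k, i, j] := by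
  have h := hG.pd_contraction (t := fun x a b => cov G U x ![b, a, k, i, j])
    (fun a b => hG.diffAt (hG.smooth_cov hU.smooth _) hy) hy m
  simp only [div4, cov_five, mul_sub, Finset.sum_sub_distrib, sum_contraction_comm] at h ⊢
  rw [h]
  ring

end IsLocalSDWeyl

end WeylFields

section Tractors

variable {G : E4 → Matrix (Fin 4) (Fin 4) ℝ} {Ω : Set E4} {y : E4}
  {U : E4 → (Fin 4 → Fin 4) → ℝ}

theorem zOf_swap (i j : Fin 4) (A B : TIdx) : zOf G U y i j B A = -zOf G U y i j A B := by
  have h1 : ∀ k l, projZ k B * projZ l A - projZ l B * projZ k A =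
      -(projZ k A * projZ l B - projZ l A * projZ k B) := fun k l => by ring
  have h2 : ∀ k, projX B * projZ k A - projZ k B * projX A =
      -(projX A * projZ k B - projZ k A * projX B) := fun k => by ring
  simp only [zOf, h1, h2, mul_neg _ (_ - _), Finset.sum_neg_distrib]
  ring

theorem zOf_Y_left (i j : Fin 4) (B : TIdx) : zOf G U y i j (.inl ()) B = 0 := by
  simp [zOf, projZ, projX, mkTractor]

theorem zOf_Y_right (i j : Fin 4) (A : TIdx) : zOf G U y i j A (.inl ()) = 0 := by
  rw [zOf_swap, zOf_Y_left, neg_zero]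

theorem zOf_X_X (i j : Fin 4) : zOf G U y i j (.inr (.inr ())) (.inr (.inr ())) = 0 := by
  simp [zOf, projZ, projX, mkTractor]

theorem zOf_Z_X (i j k : Fin 4) :
    zOf G U y i j (.inr (.inl k)) (.inr (.inr ())) = div4 G U y k i j := by
  simp [zOf, projZ, projX, mkTractor, Pi.single_apply]

theorem zOf_X_Z (i j k : Fin 4) :
    zOf G U y i j (.inr (.inr ())) (.inr (.inl k)) = -div4 G U y k i j := by
  rw [zOf_swap, zOf_Z_X]

theorem IsLocalSDWeyl.zOf_Z_Z (hU : IsLocalSDWeyl G Ω U) (hy : y ∈ Ω) (i j k l : Fin 4) :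
    zOf G U y i j (.inr (.inl k)) (.inr (.inl l)) = U y ![i, j, k, l] := by
  simp [zOf, projZ, projX, mkTractor, Pi.single_apply, mul_sub, Finset.sum_sub_distrib]
  rw [hU.skew_right y hy i j k l]
  ring

theorem covTractorForm_zOf_swap (m i j : Fin 4) (A B : TIdx) :
    covTractorForm G (zOf G U) y m i j B A = -covTractorForm G (zOf G U) y m i j A B := by
  simp only [covTractorForm, zOf_swap _ _ A B, pd_neg, zOf_swap _ _ _ B, zOf_swap _ _ A _, mul_neg,
    Finset.sum_neg_distrib]
  ring

theorem deltaTractor_zOf_swap (j : Fin 4) (A B : TIdx) :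
    deltaTractor G (zOf G U) y j B A = -deltaTractor G (zOf G U) y j A B := by
  simp only [deltaTractor, covTractorForm_zOf_swap _ _ _ A B, mul_neg, Finset.sum_neg_distrib]

theorem sum_mul_ginv_mul (hG : IsLocalMetric G Ω) (hy : y ∈ Ω) (k : Fin 4) (f : Fin 4 → ℝ) :
    ∑ i, ∑ m, ginv G y i m * (G y m k * f i) = f k := by
  have h : ∀ i, ∑ m, ginv G y i m * G y m k = if i = k then 1 else 0 := fun i => by
    have := congrFun (congrFun (hG.inv_mul hy) i) k
    rwa [Matrix.mul_apply, Matrix.one_apply] at this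
  simp only [← mul_assoc, ← Finset.sum_mul, h]
  simp

namespace IsLocalSDWeyl

variable (hG : IsLocalMetric G Ω) (hU : IsLocalSDWeyl G Ω U)
include hU

theorem covTractorForm_Y_Z (hy : y ∈ Ω) (m i j l : Fin 4) :
    covTractorForm G (zOf G U) y m i j (.inl ()) (.inr (.inl l)) = -U y ![i, j, m, l] := by
  simp [covTractorForm, tractorMatrix, zOf_Y_left, Fintype.sum_sum_type, hU.zOf_Z_Z hy, pd_const]

omit hU in
theorem covTractorForm_Y_X (m i j : Fin 4) :
    covTractorForm G (zOf G U) y m i j (.inl ()) (.inr (.inr ())) = -div4 G U y m i j := by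
  simp [covTractorForm, tractorMatrix, zOf_Y_left, Fintype.sum_sum_type, zOf_Z_X, pd_const]

include hG

theorem covTractorForm_Z_Z (hy : y ∈ Ω) (m i j k l : Fin 4) :
    covTractorForm G (zOf G U) y m i j (.inr (.inl k)) (.inr (.inl l)) =
      cov G U y ![m, i, j, k, l] - G y m k * div4 G U y l i j + G y m l * div4 G U y k i j := by
  rw [covTractorForm, pd_congr hG.isOpen (fun x hx => hU.zOf_Z_Z hx i j k l) m hy, cov_four]
  simp [tractorMatrix, zOf_Y_left, zOf_Y_right, Fintype.sum_sum_type, hU.zOf_Z_Z hy, zOf_X_Z,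
    zOf_Z_X]
  ring

theorem covTractorForm_Z_X (hy : y ∈ Ω) (m i j k : Fin 4) :
    covTractorForm G (zOf G U) y m i j (.inr (.inl k)) (.inr (.inr ())) =
      ∑ a, ∑ b, ginv G y a b * cov G (cov G U) y ![m, b, a, k, i, j]
        - ∑ c, (∑ d, schouten G y m d * ginv G y d c) * U y ![i, j, k, c] := by
  rw [covTractorForm, ← hU.pd_div4 hG hy]
  simp [tractorMatrix, zOf_Y_left, Fintype.sum_sum_type, hU.zOf_Z_Z hy, zOf_X_X, zOf_Z_X]
  ring

theorem deltaTractor_zOf_Y (hy : y ∈ Ω) (j : Fin 4) (B : TIdx) :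
    deltaTractor G (zOf G U) y j (.inl ()) B = 0 := by
  rcases B with _ | l | ⟨⟩
  · linarith [deltaTractor_zOf_swap (G := G) (U := U) (y := y) j (.inl ()) (.inl ())]
  · simp only [deltaTractor, hU.covTractorForm_Y_Z hy, mul_neg, Finset.sum_neg_distrib,
      hU.trace_free y hy, neg_zero]
  · change deltaTractor G (zOf G U) y j (.inl ()) (.inr (.inr ())) = 0
    simp only [deltaTractor, covTractorForm_Y_X, mul_neg, Finset.sum_neg_distrib,
      hU.div4_trace_free hG hy, neg_zero]

theorem deltaTractor_zOf_Z_Z (hy : y ∈ Ω) (j k l : Fin 4) :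
    deltaTractor G (zOf G U) y j (.inr (.inl k)) (.inr (.inl l)) = 0 := by
  simp only [deltaTractor, hU.covTractorForm_Z_Z hG hy, mul_add, mul_sub, Finset.sum_add_distrib,
    Finset.sum_sub_distrib]
  rw [sum_mul_ginv_mul hG hy k fun i => div4 G U y l i j,
    sum_mul_ginv_mul hG hy l fun i => div4 G U y k i j]
  have h := hU.div4_bianchi hG hy j k l
  have h1 : ∀ k, div4 G U y l k j = -div4 G U y l j k := fun k => by
    rw [← hU.div4_self_dual hG hy l k j, star2_swap, hU.div4_self_dual hG hy]
  rw [h1]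
  change div4 G U y j k l - _ + _ = 0
  linear_combination h

theorem deltaTractor_zOf_Z_X (hy : y ∈ Ω) (j k : Fin 4) :
    deltaTractor G (zOf G U) y j (.inr (.inl k)) (.inr (.inr ())) =
      (1 / 2) * dStar G U y j k := by
  have h1 : ∀ i m a b, cov G (cov G U) y ![m, b, a, k, i, j] =
      cov G (cov G U) y ![m, b, j, i, k, a] := fun i m a b => by
    rw [hU.cov_cov_skew_left hG hy m b k a, ← hU.cov_cov_pair_symm hG hy m b k a,
      hU.cov_cov_skew_left hG hy m b j i, neg_neg]
  rw [dStar, ← mul_assoc, one_div, inv_mul_cancel₀ two_ne_zero, one_mul]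
  refine Finset.sum_congr rfl fun i _ => ?_
  rw [Finset.sum_comm]
  refine Finset.sum_congr rfl fun m _ => ?_
  simp only [hU.covTractorForm_Z_X hG hy, Finset.sum_mul, Finset.mul_sum, ← Finset.sum_sub_distrib]
  refine Finset.sum_congr rfl fun a _ => Finset.sum_congr rfl fun b _ => ?_
  rw [h1, hU.skew_left y hy j i, hG.ginv_symm hy b a]
  ring

theorem deltaTractor_zOf (hy : y ∈ Ω) (j : Fin 4) (A B : TIdx) :
    deltaTractor G (zOf G U) y j A B = -(1 / 2) * ∑ l, dStar G U y j l *
      (projX A * projZ l B - projZ l A * projX B) := by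
  rcases A with _ | k | _
  · rw [hU.deltaTractor_zOf_Y hG hy]
    simp [projX, projZ, mkTractor]
  · rcases B with _ | l | _
    · rw [deltaTractor_zOf_swap, hU.deltaTractor_zOf_Y hG hy]
      simp [projX, projZ, mkTractor]
    · rw [hU.deltaTractor_zOf_Z_Z hG hy]
      simp [projX, projZ, mkTractor]
    · rw [hU.deltaTractor_zOf_Z_X hG hy]
      simp [projX, projZ, mkTractor, Pi.single_apply]
  · rcases B with _ | l | _
    · rw [deltaTractor_zOf_swap, hU.deltaTractor_zOf_Y hG hy]
      simp [projX, projZ, mkTractor]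
    · rw [deltaTractor_zOf_swap, hU.deltaTractor_zOf_Z_X hG hy]
      simp [projX, projZ, mkTractor, Pi.single_apply]
    · have h := deltaTractor_zOf_swap (G := G) (U := U) (y := y) j
        (.inr (.inr ())) (.inr (.inr ()))
      simp [projX, projZ, mkTractor]
      linarith

theorem smooth_zOf (i j : Fin 4) (A B : TIdx) :
    ContDiffOn ℝ ∞ (fun x => zOf G U x i j A B) Ω :=
  (contDiffOn_const.mul <| ContDiffOn.sum fun _ _ => ContDiffOn.sum fun _ _ =>
    (hU.smooth _).mul contDiffOn_const).sub <| ContDiffOn.sum fun _ _ =>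
      (hU.smooth_div4 hG _ _ _).mul contDiffOn_const

theorem zOf_self_dual (hy : y ∈ Ω) (i j : Fin 4) (A B : TIdx) :
    star2 G y (fun p q => zOf G U y p q A B) i j = zOf G U y i j A B := by
  simp only [zOf, mul_comm _ (projZ _ A * projZ _ B - projZ _ A * projZ _ B),
    mul_comm _ (projX A * projZ _ B - projZ _ A * projX B)]
  rw [star2_sub, star2_mul_left, star2_sum, star2_sum]
  simp only [star2_sum, star2_mul_left, hU.div4_self_dual hG hy, hU.self_dual y hy]

theorem covTractorForm_self_dual (hy : y ∈ Ω) (m i j : Fin 4) (A B : TIdx) :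
    star2 G y (fun p q => covTractorForm G (zOf G U) y m p q A B) i j =
      covTractorForm G (zOf G U) y m i j A B := by
  simp only [covTractorForm]
  rw [star2_add, star2_add, hG.star2_covForm (η := fun x p q => zOf G U x p q A B)
    (fun p q => hU.smooth_zOf hG p q A B) (fun x hx p q => hU.zOf_self_dual hG hx p q A B) hy,
    star2_sum, star2_sum]
  simp only [star2_mul_left, hU.zOf_self_dual hG hy]

theorem dTractor_zOf_eq_zero (hy : y ∈ Ω)
    (h : ∀ j A B, deltaTractor G (zOf G U) y j A B = 0) (m i j : Fin 4) (A B : TIdx) :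
    dTractor G (zOf G U) y m i j A B = 0 :=
  cyclic_sum_eq_zero (hG.ginv_symm hy) (hG.det_pos y hy)
    (T := fun m i j => covTractorForm G (zOf G U) y m i j A B)
    (fun m i j => hU.covTractorForm_self_dual hG hy m i j A B) (fun j => h j A B) m i j

end IsLocalSDWeyl

end Tractors

section Global

variable {M : Type*} [TopologicalSpace M] [ChartedSpace E4 M] [IsManifold (𝓡 4) ∞ M]
  {o : OrientedAtlas M} {g : SmoothMetric M} {U : TensorField M 4}

theorem isLocalMetric_metricComp (g : SmoothMetric M) {e : OpenPartialHomeomorph M E4}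
    (he : e ∈ IsManifold.maximalAtlas (𝓡 4) ∞ M) : IsLocalMetric (metricComp g e) e.target where
  isOpen := e.open_target
  smooth := contDiffOn_metricComp g he
  symm x _ := metricComp_symm g e x
  det_pos _ hx := (metricComp_posDef g he hx).det_pos

theorem IsSDWeylField.isLocalSDWeyl (hU : IsSDWeylField o g U) {e : OpenPartialHomeomorph M E4}
    (he : e ∈ o.charts) : IsLocalSDWeyl (metricComp g e) e.target (U.comp e) where
  smooth := hU.smooth e he
  skew_left := hU.skew_left e he
  skew_right := hU.skew_right e he
  pair_symm := hU.pair_symm e he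
  bianchi := hU.bianchi e he
  trace_free := hU.trace_free e he
  self_dual := hU.self_dual e he

end Global

end ASDTractor

end

theorem mainTheorem5 {M : Type*} [TopologicalSpace M] [ChartedSpace ASDTractor.E4 M]
    [IsManifold (𝓡 4) ∞ M] (o : ASDTractor.OrientedAtlas M) (g : ASDTractor.SmoothMetric M)
    (hg : ASDTractor.IsASD o g) (U : ASDTractor.TensorField M 4)
    (hU : ASDTractor.IsSDWeylField o g U) :
    (ASDTractor.InKerDStar o g U ↔
      ASDTractor.ZIsHarmonic o g U ∧ ASDTractor.ZIsSelfDual o g U) ∧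
    ∀ e ∈ o.charts, ∀ y ∈ e.target, ∀ (j : Fin 4) (A B : ASDTractor.TIdx),
      ASDTractor.deltaTractor (ASDTractor.metricComp g e) (ASDTractor.zComp g U e) y j A B =
        -(1 / 2) * ∑ l, ASDTractor.dStar (ASDTractor.metricComp g e) (U.comp e) y j l *
          (ASDTractor.projX A * ASDTractor.projZ l B -
            ASDTractor.projZ l A * ASDTractor.projX B) := by
  have hloc : ∀ e ∈ o.charts, ASDTractor.IsLocalMetric (ASDTractor.metricComp g e) e.target :=
    fun e he => ASDTractor.isLocalMetric_metricComp g (o.smooth he)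
  have hδ : ∀ e ∈ o.charts, ∀ y ∈ e.target, ∀ (j : Fin 4) (A B : ASDTractor.TIdx), _ :=
    fun e he y hy j A B =>
      (hU.isLocalSDWeyl he).deltaTractor_zOf (hloc e he) hy j A B
  refine ⟨⟨fun h => ⟨fun e he y hy => ?_, fun e he y hy i j A B =>
    (hU.isLocalSDWeyl he).zOf_self_dual (hloc e he) hy i j A B⟩, fun h e he y hy i j => ?_⟩, hδ⟩
  · have h0 : ∀ j A B, ASDTractor.deltaTractor (ASDTractor.metricComp g e)
        (ASDTractor.zComp g U e) y j A B = 0 := fun j A B => by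
      refine (hδ e he y hy j A B).trans ?_
      simp [h e he y hy]
    exact ⟨(hU.isLocalSDWeyl he).dTractor_zOf_eq_zero (hloc e he) hy h0, h0⟩
  · have h0 := (h.1 e he y hy).2 i (.inr (.inl j)) (.inr (.inr ()))
    have h1 := (hU.isLocalSDWeyl he).deltaTractor_zOf_Z_X (hloc e he) hy i j
    have h2 := h1.symm.trans h0
    linarith
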